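/- Let $k\ge 1$ and $n=2k-1$. A model $(\pi,\mathbf m)$ consists of a probability vector $\pi\in\Delta^{k-1}$ and a matrix $\mathbf m\in[0,1]^{n\times k}$. For $\zeta,\pi_{\min}>0$, let $\mathcal D_{n,\zeta,\pi_{\min}}$ be the set of models with $\pi_j\ge\pi_{\min}$ for all $j$ and $|\mathbf m_{ij}-\mathbf m_{ij'}|\ge\zeta$ for all $i$ and all $j\ne j'$. For two models put $$d_{\mathrm{model}}((\pi,\mathbf m),(\pi',\mathbf m'))=\min_{\rho\in S_k}\max\Big\{\max_j|\pi_j-\pi'_{\rho(j)}|,\ \max_{i,j}|\mathbf m_{ij}-\mathbf m'_{i\rho(j)}|\Big\}.$$ Random variables $X_1,\dots,X_n$ with values in $[0,1]$ are said to follow the model $(\pi,\mathbf m)$ if they are independent conditional on a latent random variable $U$ with values in $\{1,\dots,k\}$, where $\Pr(U=j)=\pi_j$ and $\mathbb E(X_i\mid U=j)=\mathbf m_{ij}$; equivalently, their joint law is $\sum_j\pi_j\bigotimes_i\nu_{ij}$ for probability measures $\nu_{ij}$ on $[0,1]$ with mean $\mathbf m_{ij}$. There are a constant $C\in\mathbb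 N$ and an algorithm (a computable function) $\mathcal A$ with the following property. Let $k\ge1$, $n=2k-1$, $0<\zeta\le1$, $\pi_{\min}>0$, $\varepsilon>0$ and $0<\delta\le\frac12$, let $(\pi,\mathbf m)\in\mathcal D_{n,\zeta,\pi_{\min}}$, let $(X_1,\dots,X_n)$ follow $(\pi,\mathbf m)$, and let $$N\ \ge\ C\,(1/\zeta)^{Ck}\,(1/\pi_{\min})^{C}\,(1/\varepsilon)^2\,\log(1/\delta)$$ be an integer. Given only $k$ and $N$ independent samples of $(X_1,\dots,X_n)$, with every observed number $x$ read to $N$ binary digits as $\lfloor 2^Nx\rfloor$ (which loses nothing for binary variables), $\mathcal A$ outputs parameters $(\tilde\pi,\tilde{\mathbf m})$ with rational entries such that, with probability at least $1-\delta$, $(\tilde\pi,\tilde{\mathbf m})$ is a model and $$d_{\mathrm{model}}((\pi,\mathbf m),(\tilde\pi,\tilde{\mathbf m}))<\varepsilon .$$ In particular, for any constant failure probability, and even for failure probability $2^{-k}$, $(1/\zeta)^{O(k)}(1/\pi_{\min})^{O(1)}(1/\varepsilon)^2$ samples suffice to compute a model within $\varepsilon$ of the truth in $d_{\mathrm{model}}$.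 -/

import Mathlib

namespace MixProd

/-- Parameters `(π, m)` of a mixture of `k` product distributions on `n` observables:
`π j` is the weight of the `j`-th component and `m i j` is the mean of the `i`-th observable
conditional on the `j`-th component. -/
abbrev Params (n k : ℕ) : Type := (Fin k → ℝ) × (Fin n → Fin k → ℝ)

/-- The models: the weights form a probability vector and all means lie in `[0,1]`. -/
def models (n k : ℕ) : Set (Params n k) :=
  {θ | θ.1 ∈ stdSimplex ℝ (Fin k) ∧ ∀ i j, θ.2 i j ∈ Set.Icc (0 : ℝ) 1}

/-- The models all of whose weights are at least `πmin` and all of whose observables are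
`ζ`-separated. -/
def separatedModels (n k : ℕ) (ζ πmin : ℝ) : Set (Params n k) :=
  {θ | θ ∈ models n k ∧ (∀ j, πmin ≤ θ.1 j) ∧
    ∀ i j j', j ≠ j' → ζ ≤ |θ.2 i j - θ.2 i j'|}

/-- The `L_∞` distance of two models up to relabelling of the components. -/
noncomputable def modelDist {n k : ℕ} (θ θ' : Params n k) : ℝ :=
  ⨅ ρ : Equiv.Perm (Fin k),
    max (⨆ j, |θ.1 j - θ'.1 (ρ j)|) (⨆ i, ⨆ j, |θ.2 i j - θ'.2 i (ρ j)|)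

/-- `P` is the joint law of `n` random variables with values in `[0,1]` that are independent
conditional on a latent variable `U` with values in `Fin k`, where `U = j` has probability
`θ.1 j` and the `i`-th variable has conditional mean `θ.2 i j` given `U = j`.
Here `ν i j` is the conditional law of the `i`-th variable given `U = j`. -/
def IsMixtureLaw {n k : ℕ} (θ : Params n k) (P : MeasureTheory.Measure (Fin n → ℝ)) : Prop :=
  ∃ ν : Fin n → Fin k → MeasureTheory.Measure ℝ,
    (∀ i j, MeasureTheory.IsProbabilityMeasure (ν i j)) ∧
    (∀ i j, ∀ᵐ x ∂(ν i j), x ∈ Set.Icc (0 : ℝ) 1) ∧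
    (∀ i j, ∫ x, x ∂(ν i j) = θ.2 i j) ∧
    P = ∑ j, ENNReal.ofReal (θ.1 j) • MeasureTheory.Measure.pi (fun i => ν i j)

/-- The joint law of `N` independent samples from `P`. -/
noncomputable def sampleLaw {n : ℕ} (N : ℕ) (P : MeasureTheory.Measure (Fin n → ℝ)) :
    MeasureTheory.Measure (Fin N → Fin n → ℝ) :=
  MeasureTheory.Measure.pi (fun _ => P)

/-- What a machine reads of a list of `N` samples: every observed number `x` is read to `N`
binary digits after the point, as the integer `⌊2 ^ N * x⌋`. (Binary data are read exactly:
`0` as `0` and `1` as `2 ^ N`.) -/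
noncomputable def digitize {n N : ℕ} (X : Fin N → Fin n → ℝ) : List (List ℕ) :=
  List.ofFn fun s => List.ofFn fun i => ⌊2 ^ N * X s i⌋₊

/-- The parameters with rational entries that are written as a common denominator `c.1`, the list
`c.2.1` of the numerators of the weights, and the list `c.2.2` of the rows of numerators of the
means (missing list entries are read as zero). -/
noncomputable def readParams (n k : ℕ) (c : ℕ × List ℕ × List (List ℕ)) : Params n k :=
  (fun j => (c.2.1.getD j 0 : ℝ) / c.1, fun i j => ((c.2.2.getD i []).getD j 0 : ℝ) / c.1)

end MixProd

/-! ### Inverting an almost diagonal linear system. -/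

namespace MixProd

open Finset

/-! The mixed moments `E ∏_{i∈S} X i` determine a separated model stably, and they can be estimated
by averages; the algorithm searches a grid of models for one whose moments fit the empirical ones
best.

Stability (`exists_perm_close_of_affineMoment`, `modelDist_le_of_moment`): split the `2k-1`
observables into two blocks of `k-1` and one observable `x`. On each block separation provides
multilinear Lagrange polynomials `F j`, `G j`, equal to `1` at component `j` of the true model and
`0` at the others, with coefficient norm at most `(2/ζ)^(k-1)`. In the true model the mean of `F i *
G j` is `w i` if `i = j` and `0` otherwise, and the extra factor `x` multiplies this by `x i`. A
competitor with nearby moments satisfies the same relations approximately. Read as matrix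
identities, they say that `w' l * F i l` has the normalised `G j l` as an approximate right inverse,
and that it nearly annihilates `(x' l - x j) * G j l`; so this vector is small
(`abs_sub_mul_abs_le`). Hence `x' l` is close to `x j` wherever `G j l` is not small. Such an `l`
exists for each `j`, and separation makes `j ↦ l` a permutation (`exists_perm_abs_le`). Away from
the matched component `F j` and `G j` are negligible, so they isolate it, and its weight and means
can be read off. The competitor needs neither separation nor a lower bound on its weights; the loss
is of order `k (2/ζ)^(4k) / πmin^2`.

Statistics: Hoeffding's inequality and a union bound over the `2^(2k-1)` subsets control all
empirical moments at once (`IsMixtureLaw.sampleLaw_real_ge`). Rounding the true model to the grid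
shows that the best grid model fits well too (`abs_moment_estimator_sub_le`). Factors exponential in
`k` are absorbed into powers of `1/ζ`, because many separated numbers in `[0,1]` force `ζ` to be
small (`two_pow_le_of_separated`). The search is bounded, hence primitive recursive
(`primrec_estimator`). -/

/-- If `B` is an approximate right inverse of the square matrix `A`, then a vector that `A` maps
to a small vector is small. -/
theorem abs_le_of_approx_right_inverse {κ : Type*} [Fintype κ] [DecidableEq κ] [Nonempty κ]
    (A B : Matrix κ κ ℝ) {e b t : ℝ} (v : κ → ℝ)
    (he : ∀ i j, |(A * B) i j - (1 : Matrix κ κ ℝ) i j| ≤ e)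
    (hke : Fintype.card κ * e ≤ 1 / 2) (hb : ∀ i j, |B i j| ≤ b)
    (ht : ∀ i, |(A.mulVec v) i| ≤ t) (l : κ) :
    |v l| ≤ 2 * Fintype.card κ * b * t := by
  -- `A * B` is within `1/2` of the identity in the sup norm, as an entry of `y` of maximal modulus
  -- shows.
  have key : ∀ (y : κ → ℝ) (s : ℝ), (∀ i, |((A * B).mulVec y) i| ≤ s) → ∀ i, |y i| ≤ 2 * s := by
    intro y s hs
    obtain ⟨i₀, -, hi₀⟩ := Finset.exists_max_image Finset.univ (fun i => |y i|)
      Finset.univ_nonempty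
    have h1 : y i₀ = ((A * B).mulVec y) i₀ - ∑ j, ((A * B) i₀ j - (1 : Matrix κ κ ℝ) i₀ j) * y j := by
      have h2 : ((1 : Matrix κ κ ℝ).mulVec y) i₀ = y i₀ := by rw [Matrix.one_mulVec]
      simp only [sub_mul, Finset.sum_sub_distrib]
      simp only [Matrix.mulVec, dotProduct] at h2 ⊢
      linarith
    have h3 : |∑ j, ((A * B) i₀ j - (1 : Matrix κ κ ℝ) i₀ j) * y j| ≤
        Fintype.card κ * e * |y i₀| := by
      refine (Finset.abs_sum_le_sum_abs _ _).trans ?_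
      have : ∀ j ∈ Finset.univ, |((A * B) i₀ j - (1 : Matrix κ κ ℝ) i₀ j) * y j| ≤ e * |y i₀| := by
        intro j _
        rw [abs_mul]
        exact mul_le_mul (he _ _) (hi₀ j (Finset.mem_univ _)) (abs_nonneg _)
          ((abs_nonneg _).trans (he i₀ j))
      refine (Finset.sum_le_card_nsmul _ _ _ this).trans ?_
      rw [nsmul_eq_mul, Finset.card_univ, mul_assoc]
    have h4 : |y i₀| ≤ s + 1 / 2 * |y i₀| := by
      calc |y i₀| ≤ |((A * B).mulVec y) i₀| +
            |∑ j, ((A * B) i₀ j - (1 : Matrix κ κ ℝ) i₀ j) * y j| := by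
            conv_lhs => rw [h1]
            exact abs_sub _ _
        _ ≤ s + 1 / 2 * |y i₀| := by
            refine add_le_add (hs _) (h3.trans ?_)
            exact mul_le_mul_of_nonneg_right hke (abs_nonneg _)
    intro i
    have := hi₀ i (Finset.mem_univ _)
    linarith
  -- Injectivity makes the square matrix `B` invertible, so `v = B y`; then `A v = (A B) y` bounds
  -- `y`, hence `v`.
  have hinj : Function.Injective B.mulVec := by
    intro x y hxy
    have h0 : (A * B).mulVec (x - y) = 0 := by
      rw [← Matrix.mulVec_mulVec, Matrix.mulVec_sub, hxy, sub_self, Matrix.mulVec_zero]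
    have := key (x - y) 0 (by intro i; simp [h0])
    funext i
    have hi := this i
    rw [mul_zero] at hi
    have := abs_nonpos_iff.1 hi
    simpa [sub_eq_zero] using this
  obtain ⟨y, rfl⟩ := (Matrix.mulVec_surjective_iff_isUnit.2
    (Matrix.mulVec_injective_iff_isUnit.1 hinj)) v
  have hy := key y t (by simpa [Matrix.mulVec_mulVec] using ht)
  have hb0 : 0 ≤ b := (abs_nonneg _).trans (hb l l)
  calc |B.mulVec y l| ≤ ∑ j, |B l j * y j| := Finset.abs_sum_le_sum_abs _ _
    _ ≤ ∑ _j : κ, b * (2 * t) := by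
        refine Finset.sum_le_sum fun j _ => ?_
        rw [abs_mul]
        exact mul_le_mul (hb _ _) (hy j) (abs_nonneg _) hb0
    _ = 2 * Fintype.card κ * b * t := by
        rw [Finset.sum_const, nsmul_eq_mul, Finset.card_univ]; ring

/-! ### Moments and multilinear test polynomials. -/

/-- The expectation of the product of affine functions `∏ i, (α i * X i + β i)` under a mixture of
products. -/
def affineMoment {ι κ : Type*} [Fintype ι] [Fintype κ] (p : κ → ℝ) (m : ι → κ → ℝ)
    (α β : ι → ℝ) : ℝ :=
  ∑ l, p l * ∏ i, (α i * m i l + β i)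

/-- The expectation of `∏ i ∈ S, X i` under a mixture of products. -/
def moment {ι κ : Type*} [Fintype κ] (p : κ → ℝ) (m : ι → κ → ℝ) (S : Finset ι) : ℝ :=
  ∑ l, p l * ∏ i ∈ S, m i l

theorem affineMoment_eq_sum_moment {ι κ : Type*} [Fintype ι] [DecidableEq ι] [Fintype κ]
    (p : κ → ℝ) (m : ι → κ → ℝ) (α β : ι → ℝ) :
    affineMoment p m α β =
      ∑ S : Finset ι, (∏ i ∈ S, α i) * (∏ i ∈ univ \ S, β i) * moment p m S := by
  unfold affineMoment moment
  simp only [Finset.prod_add, Finset.powerset_univ, Finset.mul_sum]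
  rw [Finset.sum_comm]
  refine Finset.sum_congr rfl fun S _ => Finset.sum_congr rfl fun l _ => ?_
  rw [Finset.prod_mul_distrib]
  ring

/-- Expanding the product gives a combination of moments whose coefficients have absolute values
summing to `∏ i, (|α i| + |β i|)`. -/
theorem abs_affineMoment_sub_le {ι κ : Type*} [Fintype ι] [DecidableEq ι] [Fintype κ]
    {p p' : κ → ℝ} {m m' : ι → κ → ℝ} {η : ℝ}
    (h : ∀ S, |moment p m S - moment p' m' S| ≤ η) (α β : ι → ℝ) :
    |affineMoment p m α β - affineMoment p' m' α β| ≤ η * ∏ i, (|α i| + |β i|) := by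
  rw [affineMoment_eq_sum_moment, affineMoment_eq_sum_moment, ← Finset.sum_sub_distrib,
    Finset.prod_add, Finset.powerset_univ, Finset.mul_sum]
  refine (Finset.abs_sum_le_sum_abs _ _).trans (Finset.sum_le_sum fun S _ => ?_)
  rw [← mul_sub, abs_mul, abs_mul, Finset.abs_prod, Finset.abs_prod, mul_comm]
  exact mul_le_mul_of_nonneg_right (h S) (by positivity)

theorem affineMoment_comp_equiv {ι ι' κ : Type*} [Fintype ι] [Fintype ι'] [Fintype κ]
    (e : ι' ≃ ι) (p : κ → ℝ) (m : ι → κ → ℝ) (α β : ι' → ℝ) :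
    affineMoment p (fun i => m (e i)) α β =
      affineMoment p m (fun i => α (e.symm i)) (fun i => β (e.symm i)) := by
  unfold affineMoment
  refine Finset.sum_congr rfl fun l _ => ?_
  rw [← Equiv.prod_comp e]
  simp

/-! ### Multilinear Lagrange polynomials of a separated block. -/

section Lagrange

variable {t : ℕ}

/-- Slopes of the affine factors of the multilinear Lagrange polynomial of the component `j`. -/
noncomputable def lagSlope (m : Fin t → Fin (t + 1) → ℝ) (j : Fin (t + 1)) (i : Fin t) : ℝ :=
  (m i j - m i (j.succAbove i))⁻¹

/-- Constant terms of the affine factors of the multilinear Lagrange polynomial of `j`. -/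
noncomputable def lagConst (m : Fin t → Fin (t + 1) → ℝ) (j : Fin (t + 1)) (i : Fin t) : ℝ :=
  -m i (j.succAbove i) * (m i j - m i (j.succAbove i))⁻¹

/-- The multilinear Lagrange polynomial of the component `j`: it is `1` at the `j`-th column of `m`
and vanishes at the others. -/
noncomputable def lag (m : Fin t → Fin (t + 1) → ℝ) (j : Fin (t + 1)) (x : Fin t → ℝ) : ℝ :=
  ∏ i, (lagSlope m j i * x i + lagConst m j i)

/-- Each observable has one component to kill: the factor `i` vanishes at `j.succAbove i`, and these
exhaust the components other than `j`. This is why a block needs `k - 1` observables. -/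
theorem lag_apply_of_ne {m : Fin t → Fin (t + 1) → ℝ} {j l : Fin (t + 1)} (h : l ≠ j) :
    lag m j (fun i => m i l) = 0 := by
  obtain ⟨i, rfl⟩ := Fin.exists_succAbove_eq h
  refine Finset.prod_eq_zero (Finset.mem_univ i) ?_
  simp only [lagSlope, lagConst]; ring

theorem lag_apply_self {m : Fin t → Fin (t + 1) → ℝ} {ζ : ℝ} (hζ : 0 < ζ)
    (hm : ∀ i j j', j ≠ j' → ζ ≤ |m i j - m i j'|) (j : Fin (t + 1)) :
    lag m j (fun i => m i j) = 1 := by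
  refine Finset.prod_eq_one fun i _ => ?_
  have : m i j - m i (j.succAbove i) ≠ 0 :=
    abs_pos.1 (hζ.trans_le (hm i j _ (Fin.succAbove_ne j i).symm))
  simp only [lagSlope, lagConst]
  rw [mul_comm, ← add_mul, ← sub_eq_add_neg, mul_inv_cancel₀ this]

theorem abs_lagSlope_add_abs_lagConst_le {m : Fin t → Fin (t + 1) → ℝ} {ζ : ℝ} (hζ : 0 < ζ)
    (hm : ∀ i j j', j ≠ j' → ζ ≤ |m i j - m i j'|) (h01 : ∀ i j, m i j ∈ Set.Icc (0 : ℝ) 1)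
    (j : Fin (t + 1)) (i : Fin t) : |lagSlope m j i| + |lagConst m j i| ≤ 2 / ζ := by
  have h1 := hm i j _ (Fin.succAbove_ne j i).symm
  have h2 : |lagSlope m j i| ≤ 1 / ζ := by
    rw [lagSlope, abs_inv, one_div]
    exact inv_anti₀ hζ h1
  have h3 : |lagConst m j i| ≤ 1 / ζ := by
    have : lagConst m j i = -m i (j.succAbove i) * lagSlope m j i := rfl
    rw [this, abs_mul, abs_neg, abs_of_nonneg (h01 _ _).1]
    exact (mul_le_of_le_one_left (abs_nonneg _) (h01 _ _).2).trans h2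
  calc _ ≤ 1 / ζ + 1 / ζ := add_le_add h2 h3
    _ = 2 / ζ := by ring

theorem prod_lag_norm_le {m : Fin t → Fin (t + 1) → ℝ} {ζ : ℝ} (hζ : 0 < ζ)
    (hm : ∀ i j j', j ≠ j' → ζ ≤ |m i j - m i j'|) (h01 : ∀ i j, m i j ∈ Set.Icc (0 : ℝ) 1)
    (j : Fin (t + 1)) : ∏ i, (|lagSlope m j i| + |lagConst m j i|) ≤ (2 / ζ) ^ t := by
  calc _ ≤ ∏ _i : Fin t, (2 / ζ) := Finset.prod_le_prod (fun i _ => by positivity)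
        fun i _ => abs_lagSlope_add_abs_lagConst_le hζ hm h01 j i
    _ = _ := by rw [Finset.prod_const, Finset.card_univ, Fintype.card_fin]

theorem abs_lag_le {m : Fin t → Fin (t + 1) → ℝ} {ζ : ℝ} (hζ : 0 < ζ)
    (hm : ∀ i j j', j ≠ j' → ζ ≤ |m i j - m i j'|) (h01 : ∀ i j, m i j ∈ Set.Icc (0 : ℝ) 1)
    (j : Fin (t + 1)) {x : Fin t → ℝ} (hx : ∀ i, x i ∈ Set.Icc (0 : ℝ) 1) :
    |lag m j x| ≤ (2 / ζ) ^ t := by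
  refine le_trans ?_ (prod_lag_norm_le hζ hm h01 j)
  rw [lag, Finset.abs_prod]
  refine Finset.prod_le_prod (fun i _ => abs_nonneg _) fun i _ => ?_
  refine (abs_add_le _ _).trans (add_le_add ?_ le_rfl)
  rw [abs_mul, abs_of_nonneg (hx i).1]
  exact mul_le_of_le_one_right (abs_nonneg _) (hx i).2

end Lagrange

end MixProd

/-! ### Matching the components of two models. -/

namespace MixProd

open Finset

section Align

variable {κ : Type*} [Fintype κ] [DecidableEq κ]

/-- A perturbed eigenvector argument. The matrix `w' l * F i l` sends `(x' l - x j) * G j l` to a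
difference of two test moments, whose ideal values `w i * x i` and `x j * w i` cancel for `i = j`
and vanish otherwise; approximate invertibility then bounds the vector itself. -/
theorem abs_sub_mul_abs_le [Nonempty κ] {F G : κ → κ → ℝ} {w w' x x' : κ → ℝ} {L p η : ℝ}
    (hL : 0 ≤ L) (hp : 0 < p) (hw : ∀ j, p ≤ w j) (hx : ∀ j, x j ∈ Set.Icc (0 : ℝ) 1)
    (hG : ∀ j l, |G j l| ≤ L)
    (h1 : ∀ i j, |∑ l, w' l * (F i l * G j l) - if i = j then w i else 0| ≤ η * L ^ 2)
    (h2 : ∀ i j, |∑ l, w' l * (F i l * G j l * x' l) - if i = j then w i * x i else 0| ≤ η * L ^ 2)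
    (hη : Fintype.card κ * (η * L ^ 2 / p) ≤ 1 / 2) (j l : κ) :
    |x' l - x j| * |G j l| ≤ 4 * Fintype.card κ * L ^ 3 * η / p := by
  have hη0 : 0 ≤ η * L ^ 2 := (abs_nonneg _).trans (h1 j j)
  have key := abs_le_of_approx_right_inverse (Matrix.of fun i l => w' l * F i l)
    (Matrix.of fun l j => G j l / w j) (e := η * L ^ 2 / p) (b := L / p) (t := 2 * (η * L ^ 2))
    (fun l => (x' l - x j) * G j l) ?_ hη ?_ ?_ l
  · rw [← abs_mul]
    refine key.trans (le_of_eq ?_)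
    ring
  · intro a b
    have e1 : ((Matrix.of fun i l => w' l * F i l) * (Matrix.of fun l j => G j l / w j) :
        Matrix κ κ ℝ) a b - (1 : Matrix κ κ ℝ) a b =
        (∑ l, w' l * (F a l * G b l) - if a = b then w a else 0) / w b := by
      have hb : w b ≠ 0 := (hp.trans_le (hw b)).ne'
      rw [Matrix.mul_apply, sub_div, Finset.sum_div, Matrix.one_apply]
      congr 1
      · refine Finset.sum_congr rfl fun l _ => ?_
        simp only [Matrix.of_apply]; ring
      · split_ifs with h
        · subst h; rw [div_self hb]
        · simp
    rw [e1, abs_div, abs_of_pos (hp.trans_le (hw b))]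
    exact div_le_div₀ hη0 (h1 a b) hp (hw b)
  · intro a b
    simp only [Matrix.of_apply]
    rw [abs_div, abs_of_pos (hp.trans_le (hw b))]
    exact div_le_div₀ hL (hG b a) hp (hw b)
  · intro i
    have e1 : (Matrix.of fun i l => w' l * F i l).mulVec (fun l => (x' l - x j) * G j l) i =
        (∑ l, w' l * (F i l * G j l * x' l) - if i = j then w i * x i else 0) -
        x j * (∑ l, w' l * (F i l * G j l) - if i = j then w i else 0) := by
      have e2 : (if i = j then w i * x i else 0) = x j * if i = j then w i else 0 := by
        split_ifs with h
        · subst h; ring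
        · simp
      rw [e2, mul_sub, sub_sub_sub_cancel_right, Finset.mul_sum, ← Finset.sum_sub_distrib]
      simp only [Matrix.mulVec, dotProduct, Matrix.of_apply]
      refine Finset.sum_congr rfl fun l _ => by ring
    rw [e1]
    refine (abs_sub _ _).trans ?_
    rw [abs_mul, abs_of_nonneg (hx j).1, two_mul]
    exact add_le_add (h2 i j)
      ((mul_le_of_le_one_left (abs_nonneg _) (hx j).2).trans (h1 i j))

omit [DecidableEq κ] in
theorem exists_half_le {F G w' : κ → ℝ} {L p : ℝ} (hL : 0 < L) (hw' : ∀ l, 0 ≤ w' l)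
    (hsum : ∑ l, w' l ≤ 1) (hF : ∀ l, |F l| ≤ L) (hp : 0 < p)
    (h : p / 2 ≤ ∑ l, w' l * (F l * G l)) : ∃ l, p / (2 * L) ≤ |G l| := by
  by_contra! hcon
  have h1 : ∀ l, w' l * (F l * G l) ≤ w' l * (L * (p / (2 * L))) := fun l => by
    refine mul_le_mul_of_nonneg_left ((le_abs_self _).trans ?_) (hw' l)
    rw [abs_mul]
    exact mul_le_mul (hF l) (hcon l).le (abs_nonneg _) hL.le
  have h2 : L * (p / (2 * L)) = p / 2 := by field_simp
  have h5 : ∃ l, 0 < w' l := by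
    -- A positive weight is what makes the averaged inequality strict.
    by_contra! h6
    have : ∑ l, w' l * (F l * G l) = 0 := Finset.sum_eq_zero fun l _ => by
      rw [le_antisymm (h6 l) (hw' l), zero_mul]
    linarith
  obtain ⟨l₀, hl₀⟩ := h5
  have h6 : ∑ l, w' l * (F l * G l) < ∑ l, w' l * (L * (p / (2 * L))) := by
    refine Finset.sum_lt_sum (fun l _ => h1 l) ⟨l₀, Finset.mem_univ _, ?_⟩
    refine mul_lt_mul_of_pos_left ((le_abs_self _).trans_lt ?_) hl₀
    rw [abs_mul]
    exact mul_lt_mul' (hF l₀) (hcon l₀) (abs_nonneg _) hL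
  rw [← Finset.sum_mul, h2] at h6
  nlinarith

/-- Choose for each `j` a component `r j` where `G j` is not small; there `x'` is within `ζ/4` of `x
j`, so separation forbids `r j = r j'`. Any other component is some `r j'`, where `x'` is at least
`ζ/2` away from `x j`, and the product bounds make `G j` and `F j` small. -/
theorem exists_perm_abs_le {F G : κ → κ → ℝ} {w' x x' : κ → ℝ} {L p ζ τ : ℝ}
    (hL : 0 < L) (hp : 0 < p) (hζ : 0 < ζ) (hw' : ∀ l, 0 ≤ w' l) (hsum : ∑ l, w' l ≤ 1)
    (hF : ∀ i l, |F i l| ≤ L) (hx : ∀ j j', j ≠ j' → ζ ≤ |x j - x j'|)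
    (h : ∀ j, p / 2 ≤ ∑ l, w' l * (F j l * G j l))
    (hGτ : ∀ j l, |x' l - x j| * |G j l| ≤ τ) (hFτ : ∀ j l, |x' l - x j| * |F j l| ≤ τ)
    (hτ : 2 * L * τ / p ≤ ζ / 4) :
    ∃ ρ : Equiv.Perm κ, ∀ j l, l ≠ ρ j → |G j l| ≤ 2 / ζ * τ ∧ |F j l| ≤ 2 / ζ * τ := by
  choose r hr using fun j => exists_half_le hL hw' hsum (hF j) hp (h j)
  have hclose : ∀ j, |x' (r j) - x j| ≤ ζ / 4 := fun j => by
    refine le_trans ?_ hτ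
    rw [le_div_iff₀ hp]
    have h1 : |x' (r j) - x j| * (p / (2 * L)) ≤ τ :=
      (mul_le_mul_of_nonneg_left (hr j) (abs_nonneg _)).trans (hGτ j (r j))
    rw [mul_div_assoc', div_le_iff₀ (by positivity)] at h1
    linarith
  have hinj : Function.Injective r := by
    intro j j' hjj
    by_contra hne
    have h1 := hx j j' hne
    have h2 := hclose j
    have h3 := hclose j'
    rw [← hjj] at h3
    rw [abs_le] at h2 h3
    have : |x j - x j'| ≤ ζ / 2 := abs_le.2 ⟨by linarith, by linarith⟩
    linarith
  refine ⟨Equiv.ofBijective r (Finite.injective_iff_bijective.1 hinj), fun j l hl => ?_⟩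
  obtain ⟨j', rfl⟩ := (Finite.injective_iff_surjective.1 hinj) l
  have hne : j ≠ j' := by rintro rfl; exact hl rfl
  have hfar : ζ / 2 ≤ |x' (r j') - x j| := by
    have h1 := hx j j' hne
    have h2 := hclose j'
    have h3 : |x j - x j'| ≤ |x' (r j') - x j| + |x' (r j') - x j'| := by
      rw [abs_sub_comm (x' (r j')) (x j)]
      exact abs_sub_le _ _ _
    linarith
  have aux : ∀ y : ℝ, |x' (r j') - x j| * |y| ≤ τ → |y| ≤ 2 / ζ * τ := fun y hy => by
    have : ζ / 2 * |y| ≤ τ := (mul_le_mul_of_nonneg_right hfar (abs_nonneg _)).trans hy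
    rw [div_mul_eq_mul_div, le_div_iff₀ hζ]
    linarith
  exact ⟨aux _ (hGτ _ _), aux _ (hFτ _ _)⟩

theorem abs_weight_mul_sub_le {g w' : κ → ℝ} {r : κ} {a e c : ℝ} (hw' : ∀ l, 0 ≤ w' l)
    (hsum : ∑ l, w' l ≤ 1) (hc : 0 ≤ c) (hg : ∀ l, l ≠ r → |g l| ≤ c)
    (h : |∑ l, w' l * g l - a| ≤ e) : |w' r * g r - a| ≤ e + c := by
  have h1 : |∑ l ∈ univ.erase r, w' l * g l| ≤ c := by
    refine (Finset.abs_sum_le_sum_abs _ _).trans ?_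
    calc ∑ l ∈ univ.erase r, |w' l * g l| ≤ ∑ l ∈ univ.erase r, w' l * c := by
          refine Finset.sum_le_sum fun l hl => ?_
          rw [abs_mul, abs_of_nonneg (hw' l)]
          exact mul_le_mul_of_nonneg_left (hg l (Finset.ne_of_mem_erase hl)) (hw' l)
      _ ≤ ∑ l, w' l * c := Finset.sum_le_sum_of_subset_of_nonneg (Finset.subset_univ _)
          fun l _ _ => mul_nonneg (hw' l) hc
      _ ≤ 1 * c := by rw [← Finset.sum_mul]; exact mul_le_mul_of_nonneg_right hsum hc
      _ = c := one_mul c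
  have h2 := Finset.add_sum_erase univ (fun l => w' l * g l) (Finset.mem_univ r)
  rw [abs_le] at *
  constructor <;> linarith

/-- The filter `g` is concentrated on `r`. The mean of `g * (y - b)` is nearly `a * b - b * a = 0`,
and up to the leakage `c * D` it equals `w' r * g r * (y r - b)` with `w' r * g r ≥ p / 2`. -/
theorem abs_observable_sub_le {g w' y : κ → ℝ} {r : κ} {a b p e e' c D : ℝ} (hp : 0 < p)
    (ha : p ≤ a) (hw' : ∀ l, 0 ≤ w' l) (hsum : ∑ l, w' l ≤ 1) (hc : 0 ≤ c) (hD : 0 ≤ D)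
    (hb : |b| ≤ 1) (hy : ∀ l, |y l - b| ≤ D)
    (hg : ∀ l, l ≠ r → |g l| ≤ c) (h : |∑ l, w' l * g l - a| ≤ e)
    (h' : |∑ l, w' l * (g l * y l) - a * b| ≤ e') (hsmall : e + c ≤ p / 2) :
    |y r - b| ≤ 2 * (e + e' + c * D) / p := by
  have h1 := abs_weight_mul_sub_le hw' hsum hc hg h
  have h2 : |∑ l, w' l * (g l * (y l - b)) - 0| ≤ e + e' := by
    have e1 : ∑ l, w' l * (g l * (y l - b)) - 0 =
        (∑ l, w' l * (g l * y l) - a * b) - b * (∑ l, w' l * g l - a) := by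
      rw [mul_sub, Finset.mul_sum, sub_zero, mul_comm b a, sub_sub_sub_cancel_right,
        ← Finset.sum_sub_distrib]
      exact Finset.sum_congr rfl fun l _ => by ring
    rw [e1, add_comm e]
    refine (abs_sub _ _).trans (add_le_add h' ?_)
    rw [abs_mul]
    exact (mul_le_of_le_one_left (abs_nonneg _) hb).trans h
  have h3 := abs_weight_mul_sub_le (r := r) hw' hsum (mul_nonneg hc hD)
    (g := fun l => g l * (y l - b)) (fun l hl => by
      rw [abs_mul]; exact mul_le_mul (hg l hl) (hy l) (abs_nonneg _) hc) h2
  have h4 : p / 2 ≤ w' r * g r := by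
    have := (abs_le.1 h1).1
    linarith
  rw [sub_zero, ← mul_assoc, abs_mul, abs_of_nonneg (by linarith)] at h3
  rw [le_div_iff₀ hp]
  nlinarith [abs_nonneg (y r - b)]

end Align

end MixProd

/-! ### Stability of a separated model under perturbation of its moments. -/

namespace MixProd

open Finset

section Stability

variable {t : ℕ}

theorem affineMoment_sum {κ : Type*} [Fintype κ] (w : κ → ℝ)
    (m : (Fin t ⊕ Fin t) ⊕ Unit → κ → ℝ) (a₁ b₁ a₂ b₂ : Fin t → ℝ) (a b : ℝ) :
    affineMoment w m (Sum.elim (Sum.elim a₁ a₂) fun _ => a) (Sum.elim (Sum.elim b₁ b₂) fun _ => b) =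
      ∑ l, w l * ((∏ i, (a₁ i * m (.inl (.inl i)) l + b₁ i)) *
        (∏ i, (a₂ i * m (.inl (.inr i)) l + b₂ i)) * (a * m (.inr ()) l + b)) := by
  simp [affineMoment, Fintype.prod_sum_type]

/-- Lets a test polynomial consist of one coordinate of a block, at coefficient norm `1`. -/
theorem prod_single_affine (i : Fin t) (x : Fin t → ℝ) :
    ∏ i', ((if i' = i then (1 : ℝ) else 0) * x i' + if i' = i then 0 else 1) = x i := by
  rw [Finset.prod_eq_single i]
  · simp
  · intro b _ hb; simp [hb]
  · simp

theorem prod_single_affine_norm (i : Fin t) :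
    ∏ i', (|if i' = i then (1 : ℝ) else 0| + |if i' = i then (0 : ℝ) else 1|) = 1 := by
  refine Finset.prod_eq_one fun i' _ => ?_
  split_ifs <;> simp

theorem lag_column {m : Fin t → Fin (t + 1) → ℝ} {ζ : ℝ} (hζ : 0 < ζ)
    (hm : ∀ i j j', j ≠ j' → ζ ≤ |m i j - m i j'|) (j l : Fin (t + 1)) :
    lag m j (fun i => m i l) = if l = j then 1 else 0 := by
  split_ifs with h
  · subst h; exact lag_apply_self hζ hm l
  · exact lag_apply_of_ne h

theorem sum_lag_column {m : Fin t → Fin (t + 1) → ℝ} {ζ : ℝ} (hζ : 0 < ζ)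
    (hm : ∀ i j j', j ≠ j' → ζ ≤ |m i j - m i j'|) (j : Fin (t + 1)) (y : Fin (t + 1) → ℝ) :
    ∑ l, y l * lag m j (fun i => m i l) = y j := by
  simp [lag_column hζ hm]

-- The summands of the index type are the two Lagrange blocks and the single observable that
-- distinguishes the components. All errors are measured by `E = K / 25`: the factor `2 / ζ` comes
-- from the matching, one `1 / p` from inverting the matrix and one from dividing by the weight of
-- the matched component.
set_option maxHeartbeats 2000000 in
theorem exists_perm_close_of_affineMoment {m m' : (Fin t ⊕ Fin t) ⊕ Unit → Fin (t + 1) → ℝ}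
    {w w' : Fin (t + 1) → ℝ} {ζ p η : ℝ} (hζ : 0 < ζ) (hζ1 : ζ ≤ 1) (hp : 0 < p)
    (hw : ∀ j, p ≤ w j) (hwsum : ∑ j, w j = 1) (hw' : ∀ j, 0 ≤ w' j) (hwsum' : ∑ j, w' j = 1)
    (h01 : ∀ i j, m i j ∈ Set.Icc (0 : ℝ) 1) (h01' : ∀ i j, m' i j ∈ Set.Icc (0 : ℝ) 1)
    (hm : ∀ i j j', j ≠ j' → ζ ≤ |m i j - m i j'|)
    (H : ∀ α β, |affineMoment w m α β - affineMoment w' m' α β| ≤ η * ∏ i, (|α i| + |β i|))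
    {K : ℝ} (hK : K = 25 * ((t + 1 : ℕ) * (2 / ζ) * ((2 / ζ) ^ t) ^ 4 * η / p ^ 2))
    (hη : K ≤ 1) :
    ∃ ρ : Equiv.Perm (Fin (t + 1)), ∀ j, |w j - w' (ρ j)| ≤ K ∧
      ∀ i, |m i j - m' i (ρ j)| ≤ K := by
  set Λ : ℝ := 2 / ζ with hΛ
  set L : ℝ := Λ ^ t with hL
  have hΛ2 : 2 ≤ Λ := by rw [hΛ, le_div_iff₀ hζ]; linarith
  have hL1 : 1 ≤ L := one_le_pow₀ (by linarith)
  have hL0 : 0 < L := by linarith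
  have hη0 : 0 ≤ η := by
    have := H (fun _ => 1) (fun _ => 0)
    simp only [abs_one, abs_zero, add_zero, Finset.prod_const_one, mul_one] at this
    exact (abs_nonneg _).trans this
  have hp1 : p ≤ 1 := (hw 0).trans (by
    rw [← hwsum]
    exact Finset.single_le_sum (fun j _ => hp.le.trans (hw j)) (Finset.mem_univ _))
  set k : ℝ := ((t + 1 : ℕ) : ℝ) with hk
  have hk1 : 1 ≤ k := by rw [hk]; exact_mod_cast Nat.succ_le_succ (Nat.zero_le t)
  set E : ℝ := k * Λ * L ^ 4 * η / p ^ 2 with hE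
  have hE0 : 0 ≤ E := by positivity
  have hEp : p * (p * E) = k * Λ * L ^ 4 * η := by rw [hE]; field_simp
  set τ : ℝ := 4 * k * L ^ 3 * η / p with hτ
  have hτ0 : 0 ≤ τ := by positivity
  set c : ℝ := Λ * τ with hc
  have hc0 : 0 ≤ c := by positivity
  have hLη : L * η ≤ η * L ^ 2 := by nlinarith [mul_nonneg hη0 hL0.le]
  have hkη : k * (η * L ^ 2) ≤ p * (p * E) := by
    rw [hEp]
    have e1 : 1 ≤ Λ * L ^ 2 := by
      have : 1 ≤ L ^ 2 := one_le_pow₀ hL1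
      nlinarith
    calc k * (η * L ^ 2) = k * (η * L ^ 2) * 1 := by ring
      _ ≤ k * (η * L ^ 2) * (Λ * L ^ 2) := mul_le_mul_of_nonneg_left e1 (by positivity)
      _ = _ := by ring
  have hpE : p * (p * E) ≤ p * E := mul_le_of_le_one_left (by positivity) hp1
  have hηL : η * L ^ 2 ≤ p * E := by
    refine le_trans ?_ (hkη.trans hpE)
    exact le_mul_of_one_le_left (by positivity) hk1
  have hpEE : p * E ≤ E := mul_le_of_le_one_left hE0 hp1
  have hcL : c * L = 4 * (p * E) := by
    rw [hc, hτ, hE]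
    field_simp
  have hcle : c ≤ 4 * (p * E) := by
    rw [← hcL]; exact le_mul_of_one_le_right hc0 hL1
  -- the test polynomials
  have T : ∀ (a₁ b₁ a₂ b₂ : Fin t → ℝ) (a b : ℝ),
      |∑ l, w' l * ((∏ i, (a₁ i * m' (.inl (.inl i)) l + b₁ i)) *
        (∏ i, (a₂ i * m' (.inl (.inr i)) l + b₂ i)) * (a * m' (.inr ()) l + b)) -
       ∑ l, w l * ((∏ i, (a₁ i * m (.inl (.inl i)) l + b₁ i)) *
        (∏ i, (a₂ i * m (.inl (.inr i)) l + b₂ i)) * (a * m (.inr ()) l + b))| ≤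
      η * ((∏ i, (|a₁ i| + |b₁ i|)) * (∏ i, (|a₂ i| + |b₂ i|)) * (|a| + |b|)) := by
    intro a₁ b₁ a₂ b₂ a b
    have := H (Sum.elim (Sum.elim a₁ a₂) fun _ => a) (Sum.elim (Sum.elim b₁ b₂) fun _ => b)
    rw [affineMoment_sum, affineMoment_sum, abs_sub_comm] at this
    simpa [Fintype.prod_sum_type] using this
  set m₁ : Fin t → Fin (t + 1) → ℝ := fun i => m (.inl (.inl i)) with hm₁
  set m₂ : Fin t → Fin (t + 1) → ℝ := fun i => m (.inl (.inr i)) with hm₂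
  set F : Fin (t + 1) → Fin (t + 1) → ℝ := fun j l => lag m₁ j fun i => m' (.inl (.inl i)) l with hF
  set G : Fin (t + 1) → Fin (t + 1) → ℝ := fun j l => lag m₂ j fun i => m' (.inl (.inr i)) l with hG
  have s₁ : ∀ i j j', j ≠ j' → ζ ≤ |m₁ i j - m₁ i j'| := fun i => hm _
  have s₂ : ∀ i j j', j ≠ j' → ζ ≤ |m₂ i j - m₂ i j'| := fun i => hm _
  have u₁ : ∀ i j, m₁ i j ∈ Set.Icc (0 : ℝ) 1 := fun i => h01 _
  have u₂ : ∀ i j, m₂ i j ∈ Set.Icc (0 : ℝ) 1 := fun i => h01 _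
  have hFL : ∀ j l, |F j l| ≤ L := fun j l => abs_lag_le hζ s₁ u₁ j fun i => h01' _ _
  have hGL : ∀ j l, |G j l| ≤ L := fun j l => abs_lag_le hζ s₂ u₂ j fun i => h01' _ _
  have n₁ := prod_lag_norm_le hζ s₁ u₁
  have n₂ := prod_lag_norm_le hζ s₂ u₂
  have nn₁ : ∀ j, 0 ≤ ∏ i, (|lagSlope m₁ j i| + |lagConst m₁ j i|) := fun j => by positivity
  have nn₂ : ∀ j, 0 ≤ ∏ i, (|lagSlope m₂ j i| + |lagConst m₂ j i|) := fun j => by positivity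
  -- The factor `a * x + b` covers both uses of the last observable: absent for `(0, 1)`, present
  -- for `(1, 0)`.
  have hFG : ∀ (i j : Fin (t + 1)) (a b : ℝ), |a| + |b| = 1 →
      |∑ l, w' l * (F i l * G j l * (a * m' (.inr ()) l + b)) -
        if i = j then w i * (a * m (.inr ()) i + b) else 0| ≤ η * L ^ 2 := by
    intro i j a b hab
    have h := T (lagSlope m₁ i) (lagConst m₁ i) (lagSlope m₂ j) (lagConst m₂ j) a b
    have e : ∑ l, w l * (lag m₁ i (fun i => m₁ i l) * lag m₂ j (fun i => m₂ i l) *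
        (a * m (.inr ()) l + b)) = if i = j then w i * (a * m (.inr ()) i + b) else 0 := by
      simp only [lag_column hζ s₁, lag_column hζ s₂]
      rw [Finset.sum_eq_single i]
      · by_cases h : i = j <;> simp [h]
      · intro b _ hb; simp [hb]
      · simp
    rw [← e]
    refine h.trans (mul_le_mul_of_nonneg_left ?_ hη0)
    rw [hab, mul_one, pow_two]
    exact mul_le_mul (n₁ i) (n₂ j) (nn₂ j) hL0.le
  have h1 : ∀ i j, |∑ l, w' l * (F i l * G j l) - if i = j then w i else 0| ≤ η * L ^ 2 :=
    fun i j => by simpa using hFG i j 0 1 (by simp)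
  have h2 : ∀ i j, |∑ l, w' l * (F i l * G j l * m' (.inr ()) l) -
      if i = j then w i * m (.inr ()) i else 0| ≤ η * L ^ 2 :=
    fun i j => by simpa using hFG i j 1 0 (by simp)
  have hG0 : ∀ (j : Fin (t + 1)) (a b : ℝ), |a| + |b| = 1 →
      |∑ l, w' l * (G j l * (a * m' (.inr ()) l + b)) - w j * (a * m (.inr ()) j + b)| ≤
        L * η := by
    intro j a b hab
    have h := T (fun _ => 0) (fun _ => 1) (lagSlope m₂ j) (lagConst m₂ j) a b
    have e := sum_lag_column hζ s₂ j fun l => w l * (a * m (.inr ()) l + b)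
    simp only [zero_mul, zero_add, Finset.prod_const_one, one_mul, abs_zero, abs_one, hab,
      mul_one] at h
    rw [← e, mul_comm L]
    simp only [mul_assoc (w _)]
    simp only [mul_comm (a * m _ _ + b)]
    exact h.trans (mul_le_mul_of_nonneg_left (n₂ j) hη0)
  have hG1 : ∀ j, |∑ l, w' l * G j l - w j| ≤ L * η :=
    fun j => by simpa using hG0 j 0 1 (by simp)
  have hGx : ∀ j, |∑ l, w' l * (G j l * m' (.inr ()) l) - w j * m (.inr ()) j| ≤ L * η :=
    fun j => by simpa using hG0 j 1 0 (by simp)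
  -- Test polynomials must be multilinear, so an observable is filtered by the Lagrange polynomial
  -- of the block it does not belong to: `G` for the first block, `F` for the second.
  have hGx₁ : ∀ j i, |∑ l, w' l * (G j l * m' (.inl (.inl i)) l) - w j * m (.inl (.inl i)) j| ≤
      L * η := by
    intro j i
    have h := T (fun i' => if i' = i then 1 else 0) (fun i' => if i' = i then 0 else 1)
      (lagSlope m₂ j) (lagConst m₂ j) 0 1
    have e := sum_lag_column hζ s₂ j fun l => w l * m (.inl (.inl i)) l
    simp only [prod_single_affine i fun i => m (.inl (.inl i)) _,
      prod_single_affine i fun i => m' (.inl (.inl i)) _, prod_single_affine_norm,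
      zero_mul, zero_add, one_mul, abs_zero, abs_one, mul_one] at h
    rw [← e, mul_comm L]
    simp only [mul_assoc (w _), mul_comm (G _ _)]
    exact h.trans (mul_le_mul_of_nonneg_left (n₂ j) hη0)
  have hF1 : ∀ j, |∑ l, w' l * F j l - w j| ≤ L * η := by
    intro j
    have h := T (lagSlope m₁ j) (lagConst m₁ j) (fun _ => 0) (fun _ => 1) 0 1
    have e := sum_lag_column hζ s₁ j w
    simp only [zero_mul, zero_add, Finset.prod_const_one, abs_zero, abs_one, mul_one] at h
    rw [← e, mul_comm L]
    exact h.trans (mul_le_mul_of_nonneg_left (n₁ j) hη0)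
  have hFx₂ : ∀ j i, |∑ l, w' l * (F j l * m' (.inl (.inr i)) l) - w j * m (.inl (.inr i)) j| ≤
      L * η := by
    intro j i
    have h := T (lagSlope m₁ j) (lagConst m₁ j) (fun i' => if i' = i then 1 else 0)
      (fun i' => if i' = i then 0 else 1) 0 1
    have e := sum_lag_column hζ s₁ j fun l => w l * m (.inl (.inr i)) l
    simp only [prod_single_affine i fun i => m (.inl (.inr i)) _,
      prod_single_affine i fun i => m' (.inl (.inr i)) _, prod_single_affine_norm,
      zero_mul, zero_add, abs_zero, abs_one, mul_one] at h
    rw [← e, mul_comm L]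
    simp only [mul_right_comm (w _) (m _ _), mul_assoc (w _)]
    exact h.trans (mul_le_mul_of_nonneg_left (n₁ j) hη0)
  -- the alignment of the components
  have hsm : (Fintype.card (Fin (t + 1)) : ℝ) * (η * L ^ 2 / p) ≤ 1 / 2 := by
    rw [Fintype.card_fin, ← hk, mul_div_assoc', div_le_iff₀ hp]
    nlinarith
  have hGτ : ∀ j l, |m' (.inr ()) l - m (.inr ()) j| * |G j l| ≤ τ := fun j l => by
    have := abs_sub_mul_abs_le hL0.le hp hw (h01 (.inr ())) hGL h1 h2 hsm j l
    rwa [Fintype.card_fin, ← hk] at this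
  have hFτ : ∀ j l, |m' (.inr ()) l - m (.inr ()) j| * |F j l| ≤ τ := fun j l => by
    have h1' : ∀ i j, |∑ l, w' l * (G i l * F j l) - if i = j then w i else 0| ≤ η * L ^ 2 := by
      intro i j
      convert h1 j i using 3
      · exact Finset.sum_congr rfl fun l _ => by ring
      · by_cases h : i = j
        · simp [h]
        · simp [h, Ne.symm h]
    have h2' : ∀ i j, |∑ l, w' l * (G i l * F j l * m' (.inr ()) l) -
        if i = j then w i * m (.inr ()) i else 0| ≤ η * L ^ 2 := by
      intro i j
      convert h2 j i using 3
      · exact Finset.sum_congr rfl fun l _ => by ring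
      · by_cases h : i = j
        · simp [h]
        · simp [h, Ne.symm h]
    have := abs_sub_mul_abs_le hL0.le hp hw (h01 (.inr ())) hFL h1' h2' hsm j l
    rwa [Fintype.card_fin, ← hk] at this
  obtain ⟨ρ, hρ⟩ := exists_perm_abs_le (x := m (.inr ())) hL0 hp hζ hw' hwsum'.le hFL (hm _)
    (fun j => by
      have h := h1 j j
      rw [if_pos rfl, abs_le] at h
      have := hw j
      nlinarith) hGτ hFτ (by
      have e : 2 * L * τ / p * Λ = 8 * E := by
        rw [hτ, hE]; field_simp; ring
      have e2 : ζ / 4 * Λ = 1 / 2 := by rw [hΛ]; field_simp; norm_num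
      refine le_of_mul_le_mul_right (a := Λ) ?_ (by linarith)
      rw [e, e2]; linarith)
  have hsmall : L * η + c ≤ p / 2 := by nlinarith
  have hfin : 2 * (L * η + L * η + c * 1) / p ≤ K := by
    rw [div_le_iff₀ hp, hK]
    nlinarith
  have hb : ∀ i j, |m i j| ≤ 1 := fun i j => abs_le.2 ⟨by linarith [(h01 i j).1], (h01 i j).2⟩
  have hD : ∀ i j l, |m' i l - m i j| ≤ 1 := fun i j l =>
    abs_le.2 ⟨by linarith [(h01 i j).2, (h01' i l).1], by linarith [(h01 i j).1, (h01' i l).2]⟩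
  refine ⟨ρ, fun j => ⟨?_, ?_⟩⟩
  -- For the weight, `F j` itself is treated as an observable of true value `1`, filtered by `G j`.
  -- With `F j (ρ j)` close to `1`, `w' (ρ j) * F j (ρ j)` close to `w j` yields the weight; the
  -- errors `20 E` and `5 E` add up to `K`.
  · have hFcl := abs_observable_sub_le (r := ρ j) (y := F j) (b := 1) (D := 2 * L) hp (hw j) hw'
      hwsum'.le hc0 (by positivity) (by simp)
      (fun l => (abs_sub _ _).trans (by rw [abs_one]; linarith [hFL j l]))
      (fun l hl => (hρ j l hl).1) (hG1 j) (e' := η * L ^ 2) (by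
        have := h1 j j
        rw [if_pos rfl] at this
        simpa [mul_comm] using this) hsmall
    have hwF := abs_weight_mul_sub_le (r := ρ j) hw' hwsum'.le hc0 (fun l hl => (hρ j l hl).2) (hF1 j)
    have h3 : 2 * (L * η + η * L ^ 2 + c * (2 * L)) / p ≤ 20 * E := by
      rw [div_le_iff₀ hp]
      nlinarith
    have hw1 : w' (ρ j) ≤ 1 := by
      rw [← hwsum']; exact Finset.single_le_sum (fun j _ => hw' j) (Finset.mem_univ _)
    have h4 : |w' (ρ j) * (F j (ρ j) - 1)| ≤ 20 * E := by
      rw [abs_mul, abs_of_nonneg (hw' _)]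
      exact (mul_le_of_le_one_left (abs_nonneg _) hw1).trans (hFcl.trans h3)
    have e : w j - w' (ρ j) = w' (ρ j) * (F j (ρ j) - 1) - (w' (ρ j) * F j (ρ j) - w j) := by ring
    rw [e, hK]
    refine (abs_sub _ _).trans ?_
    nlinarith
  · rintro ((i | i) | i)
    · rw [abs_sub_comm]
      exact (abs_observable_sub_le hp (hw j) hw' hwsum'.le hc0 zero_le_one (hb _ _)
        (hD _ j) (fun l hl => (hρ j l hl).1) (hG1 j) (hGx₁ j i) hsmall).trans hfin
    · rw [abs_sub_comm]
      exact (abs_observable_sub_le hp (hw j) hw' hwsum'.le hc0 zero_le_one (hb _ _)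
        (hD _ j) (fun l hl => (hρ j l hl).2) (hF1 j) (hFx₂ j i) hsmall).trans hfin
    · rw [abs_sub_comm]
      exact (abs_observable_sub_le hp (hw j) hw' hwsum'.le hc0 zero_le_one (hb _ _)
        (hD _ j) (fun l hl => (hρ j l hl).1) (hG1 j) (hGx j) hsmall).trans hfin

end Stability

end MixProd

/-! ### Primitive recursive arithmetic, bounded minimisation and digit codes. -/

namespace MixProd

open Finset

section Primitive

variable {α : Type*} [Primcodable α]

theorem primrec_add {f g : α → ℕ} (hf : Primrec f) (hg : Primrec g) :
    Primrec fun a => f a + g a := Primrec.nat_add.comp hf hg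

theorem primrec_mul {f g : α → ℕ} (hf : Primrec f) (hg : Primrec g) :
    Primrec fun a => f a * g a := Primrec.nat_mul.comp hf hg

theorem primrec_sub {f g : α → ℕ} (hf : Primrec f) (hg : Primrec g) :
    Primrec fun a => f a - g a := Primrec.nat_sub.comp hf hg

theorem primrec_sum_range {f : α → ℕ} {g : α → ℕ → ℕ} (hf : Primrec f)
    (hg : Primrec fun p : α × ℕ => g p.1 p.2) :
    Primrec fun a => ∑ i ∈ range (f a), g a i := by
  have h : Primrec₂ fun (a : α) (n : ℕ) =>
      (Nat.rec 0 (fun i IH => IH + g a i) n : ℕ) :=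
    Primrec.nat_rec (f := fun _ => 0) (g := fun a p => p.2 + g a p.1) (Primrec.const 0)
      (primrec_add (Primrec.snd.comp Primrec.snd)
        (hg.comp (Primrec.pair Primrec.fst (Primrec.fst.comp Primrec.snd))))
  refine (h.comp Primrec.id hf).of_eq fun a => ?_
  simp only [id]
  induction f a with
  | zero => rfl
  | succ n ih => rw [Finset.sum_range_succ, ← ih]

theorem primrec_prod_range {f : α → ℕ} {g : α → ℕ → ℕ} (hf : Primrec f)
    (hg : Primrec fun p : α × ℕ => g p.1 p.2) :
    Primrec fun a => ∏ i ∈ range (f a), g a i := by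
  have h : Primrec₂ fun (a : α) (n : ℕ) =>
      (Nat.rec 1 (fun i IH => IH * g a i) n : ℕ) :=
    Primrec.nat_rec (f := fun _ => 1) (g := fun a p => p.2 * g a p.1) (Primrec.const 1)
      (primrec_mul (Primrec.snd.comp Primrec.snd)
        (hg.comp (Primrec.pair Primrec.fst (Primrec.fst.comp Primrec.snd))))
  refine (h.comp Primrec.id hf).of_eq fun a => ?_
  simp only [id]
  induction f a with
  | zero => rfl
  | succ n ih => rw [Finset.prod_range_succ, ← ih]

theorem primrec_pow {f g : α → ℕ} (hf : Primrec f) (hg : Primrec g) :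
    Primrec fun a => f a ^ g a :=
  (primrec_prod_range hg (g := fun a _ => f a) (hf.comp Primrec.fst)).of_eq fun a => by simp

/-- The first minimiser of `f` among the numbers below `n` (and `0` if `n = 0`). -/
def argminBelow (f : ℕ → ℕ) : ℕ → ℕ
  | 0 => 0
  | n + 1 => if f n < f (argminBelow f n) then n else argminBelow f n

theorem primrec_argminBelow {n : α → ℕ} {f : α → ℕ → ℕ} (hn : Primrec n)
    (hf : Primrec fun p : α × ℕ => f p.1 p.2) : Primrec fun a => argminBelow (f a) (n a) := by
  have h : Primrec₂ fun (a : α) (n : ℕ) =>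
      (Nat.rec 0 (fun i IH => if f a i < f a IH then i else IH) n : ℕ) := by
    refine Primrec.nat_rec (f := fun _ => 0)
      (g := fun a p => if f a p.1 < f a p.2 then p.1 else p.2) (Primrec.const 0) ?_
    refine Primrec.ite (Primrec.nat_lt.comp ?_ ?_) (Primrec.fst.comp Primrec.snd)
      (Primrec.snd.comp Primrec.snd)
    · exact hf.comp (Primrec.pair Primrec.fst (Primrec.fst.comp Primrec.snd))
    · exact hf.comp (Primrec.pair Primrec.fst (Primrec.snd.comp Primrec.snd))
  refine (h.comp Primrec.id hn).of_eq fun a => ?_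
  simp only [id]
  induction n a with
  | zero => rfl
  | succ n ih => simp only [argminBelow, ← ih]

theorem argminBelow_spec (f : ℕ → ℕ) {n c : ℕ} (hc : c < n) :
    argminBelow f n < n ∧ f (argminBelow f n) ≤ f c := by
  induction n generalizing c with
  | zero => omega
  | succ n ih =>
    rw [argminBelow]
    -- The default `0` of the empty search is the only candidate below `1`.
    rcases Nat.eq_zero_or_pos n with rfl | hn
    · obtain rfl : c = 0 := by omega
      simp [argminBelow]
    split_ifs with h
    · refine ⟨by omega, ?_⟩
      rcases Nat.lt_succ_iff_lt_or_eq.1 hc with hc | rfl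
      · exact h.le.trans (ih hc).2
      · exact le_rfl
    · refine ⟨by have := (ih hn).1; omega, ?_⟩
      rcases Nat.lt_succ_iff_lt_or_eq.1 hc with hc | rfl
      · exact (ih hc).2
      · exact not_lt.1 h

/-- The `i`-th digit of `c` in base `b`. -/
def digit (b c i : ℕ) : ℕ := c / b ^ i % b

theorem primrec_digit {b c i : α → ℕ} (hb : Primrec b) (hc : Primrec c) (hi : Primrec i) :
    Primrec fun a => digit (b a) (c a) (i a) :=
  Primrec.nat_mod.comp (Primrec.nat_div.comp hc (primrec_pow hb hi)) hb

theorem exists_digit_eq {b : ℕ} (n : ℕ) (d : ℕ → ℕ) (hd : ∀ i < n, d i < b) :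
    ∃ c < b ^ n, ∀ i < n, digit b c i = d i := by
  let g : Fin n → Fin b := fun i => ⟨d i, hd i i.2⟩
  refine ⟨finFunctionFinEquiv g, (finFunctionFinEquiv g).2, fun i hi => ?_⟩
  have := finFunctionFinEquiv_symm_apply_val (finFunctionFinEquiv g) ⟨i, hi⟩
  rw [Equiv.symm_apply_apply] at this
  exact this.symm

theorem digit_lt {b : ℕ} (hb : 0 < b) (c i : ℕ) : digit b c i < b := Nat.mod_lt _ hb

end Primitive

/-! ### The grid search in integer arithmetic. -/

section Estimator

/-- The numerator of the `j`-th weight of the model with code `c`, over the denominator `2 ^ N`. -/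
def gridWeight (N c j : ℕ) : ℕ := digit (2 ^ N + 1) c j

/-- The numerator of the mean `(i, j)` of the model with code `c`, over the denominator `2 ^ N`. -/
def gridMean (N k c i j : ℕ) : ℕ := digit (2 ^ N + 1) c (k + i * k + j)

/-- The number of codes of models with `k` components. -/
def numCodes (N k : ℕ) : ℕ := (2 ^ N + 1) ^ (k + (2 * k - 1) * k)

/-- The numerator, over `2 ^ (N * (n + 1))`, of the moment of the model with code `c` that belongs
to the set of observables with code `s`. -/
def gridMoment (N k c s : ℕ) : ℕ :=
  ∑ j ∈ range k, gridWeight N c j *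
    -- An observable outside the set contributes `2 ^ N`, that is, the value `1`, so all products
    -- share one denominator.
    ∏ i ∈ range (2 * k - 1), (digit 2 s i * gridMean N k c i j + (1 - digit 2 s i) * 2 ^ N)

/-- The numerator, over `N * 2 ^ (N * n)`, of the empirical moment of the data `D` that belongs to
the set of observables with code `s`. -/
def dataMoment (k : ℕ) (D : List (List ℕ)) (s : ℕ) : ℕ :=
  ∑ r ∈ range D.length, ∏ i ∈ range (2 * k - 1),
    (digit 2 s i * (D.getD r []).getD i 0 + (1 - digit 2 s i) * 2 ^ D.length)

/-- The distance of two natural numbers. -/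
def ndist (a b : ℕ) : ℕ := (a - b) + (b - a)

/-- The sum of the deviations of the moments of the model with code `c` from the empirical ones,
over the common denominator `N * 2 ^ (N * (n + 1))`. -/
def discrepancy (k : ℕ) (D : List (List ℕ)) (c : ℕ) : ℕ :=
  ∑ s ∈ range (2 ^ (2 * k - 1)),
    ndist (D.length * gridMoment D.length k c s) (2 ^ D.length * dataMoment k D s)

/-- The deviation of the sum of the weights with code `c` from `1`. -/
def weightGap (N k c : ℕ) : ℕ := ndist (∑ j ∈ range k, gridWeight N c j) (2 ^ N)

/-- The discrepancy with a prohibitive penalty for weights that do not sum up to `1`. -/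
def score (k : ℕ) (D : List (List ℕ)) (c : ℕ) : ℕ :=
  discrepancy k D c +
    weightGap D.length k c * (1 + ∑ c' ∈ range (numCodes D.length k), discrepancy k D c')

/-- The code of the model of least discrepancy on the grid. -/
def bestCode (k : ℕ) (D : List (List ℕ)) : ℕ := argminBelow (score k D) (numCodes D.length k)

/-- The minimum-discrepancy estimator on the grid. -/
def estimator (p : ℕ × List (List ℕ)) : ℕ × List ℕ × List (List ℕ) :=
  (2 ^ p.2.length, (List.range p.1).map fun j => gridWeight p.2.length (bestCode p.1 p.2) j,
    (List.range (2 * p.1 - 1)).map fun i => (List.range p.1).map fun j =>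
      gridMean p.2.length p.1 (bestCode p.1 p.2) i j)

variable {α : Type*} [Primcodable α]

theorem primrec_two_mul_sub_one {k : α → ℕ} (hk : Primrec k) : Primrec fun a => 2 * k a - 1 :=
  primrec_sub (primrec_mul (Primrec.const 2) hk) (Primrec.const 1)

theorem primrec_two_pow {N : α → ℕ} (hN : Primrec N) : Primrec fun a => 2 ^ N a :=
  primrec_pow (Primrec.const 2) hN

theorem primrec_gridWeight {N c j : α → ℕ} (hN : Primrec N) (hc : Primrec c) (hj : Primrec j) :
    Primrec fun a => gridWeight (N a) (c a) (j a) :=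
  primrec_digit (Primrec.succ.comp (primrec_two_pow hN)) hc hj

theorem primrec_gridMean {N k c i j : α → ℕ} (hN : Primrec N) (hk : Primrec k) (hc : Primrec c)
    (hi : Primrec i) (hj : Primrec j) :
    Primrec fun a => gridMean (N a) (k a) (c a) (i a) (j a) :=
  primrec_digit (Primrec.succ.comp (primrec_two_pow hN)) hc
    (primrec_add (primrec_add hk (primrec_mul hi hk)) hj)

theorem primrec_numCodes {N k : α → ℕ} (hN : Primrec N) (hk : Primrec k) :
    Primrec fun a => numCodes (N a) (k a) :=
  primrec_pow (Primrec.succ.comp (primrec_two_pow hN))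
    (primrec_add hk (primrec_mul (primrec_two_mul_sub_one hk) hk))

theorem primrec_ndist {f g : α → ℕ} (hf : Primrec f) (hg : Primrec g) :
    Primrec fun a => ndist (f a) (g a) :=
  primrec_add (primrec_sub hf hg) (primrec_sub hg hf)

theorem primrec_gridMoment {N k c s : α → ℕ} (hN : Primrec N) (hk : Primrec k) (hc : Primrec c)
    (hs : Primrec s) : Primrec fun a => gridMoment (N a) (k a) (c a) (s a) := by
  refine primrec_sum_range hk (primrec_mul
    (primrec_gridWeight (hN.comp Primrec.fst) (hc.comp Primrec.fst) Primrec.snd) ?_)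
  refine primrec_prod_range (primrec_two_mul_sub_one (hk.comp Primrec.fst)) ?_
  have h : Primrec fun p : (α × ℕ) × ℕ => p.1.1 := Primrec.fst.comp Primrec.fst
  have hd := primrec_digit (Primrec.const 2) (hs.comp h) Primrec.snd
  exact primrec_add (primrec_mul hd (primrec_gridMean (hN.comp h) (hk.comp h) (hc.comp h)
      Primrec.snd (Primrec.snd.comp Primrec.fst)))
    (primrec_mul (primrec_sub (Primrec.const 1) hd) (primrec_two_pow (hN.comp h)))

theorem primrec_dataMoment {k s : α → ℕ} {D : α → List (List ℕ)} (hk : Primrec k)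
    (hD : Primrec D) (hs : Primrec s) : Primrec fun a => dataMoment (k a) (D a) (s a) := by
  refine primrec_sum_range (Primrec.list_length.comp hD) ?_
  refine primrec_prod_range (primrec_two_mul_sub_one (hk.comp Primrec.fst)) ?_
  have h : Primrec fun p : (α × ℕ) × ℕ => p.1.1 := Primrec.fst.comp Primrec.fst
  have hd := primrec_digit (Primrec.const 2) (hs.comp h) Primrec.snd
  exact primrec_add (primrec_mul hd ((Primrec.list_getD 0).comp
      ((Primrec.list_getD []).comp (hD.comp h) (Primrec.snd.comp Primrec.fst)) Primrec.snd))
    (primrec_mul (primrec_sub (Primrec.const 1) hd)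
      (primrec_two_pow (Primrec.list_length.comp (hD.comp h))))

theorem primrec_discrepancy {k c : α → ℕ} {D : α → List (List ℕ)} (hk : Primrec k)
    (hD : Primrec D) (hc : Primrec c) : Primrec fun a => discrepancy (k a) (D a) (c a) := by
  refine primrec_sum_range (primrec_two_pow (primrec_two_mul_sub_one hk)) ?_
  have hN := Primrec.list_length.comp (hD.comp (Primrec.fst : Primrec (Prod.fst : α × ℕ → α)))
  exact primrec_ndist (primrec_mul hN (primrec_gridMoment hN (hk.comp Primrec.fst)
      (hc.comp Primrec.fst) Primrec.snd))
    (primrec_mul (primrec_two_pow hN)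
      (primrec_dataMoment (hk.comp Primrec.fst) (hD.comp Primrec.fst) Primrec.snd))

theorem primrec_score {k c : α → ℕ} {D : α → List (List ℕ)} (hk : Primrec k)
    (hD : Primrec D) (hc : Primrec c) : Primrec fun a => score (k a) (D a) (c a) := by
  have hN := Primrec.list_length.comp hD
  refine primrec_add (primrec_discrepancy hk hD hc) (primrec_mul (primrec_ndist
    (primrec_sum_range hk (primrec_gridWeight (hN.comp Primrec.fst) (hc.comp Primrec.fst)
      Primrec.snd)) (primrec_two_pow hN)) (primrec_add (Primrec.const 1) ?_))
  exact primrec_sum_range (primrec_numCodes hN hk)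
    (primrec_discrepancy (hk.comp Primrec.fst) (hD.comp Primrec.fst) Primrec.snd)

theorem primrec_bestCode {k : α → ℕ} {D : α → List (List ℕ)} (hk : Primrec k)
    (hD : Primrec D) : Primrec fun a => bestCode (k a) (D a) :=
  primrec_argminBelow (primrec_numCodes (Primrec.list_length.comp hD) hk)
    (primrec_score (hk.comp Primrec.fst) (hD.comp Primrec.fst) Primrec.snd)

theorem primrec_estimator : Primrec estimator := by
  have hk : Primrec fun p : ℕ × List (List ℕ) => p.1 := Primrec.fst
  have hD : Primrec fun p : ℕ × List (List ℕ) => p.2 := Primrec.snd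
  have hN := Primrec.list_length.comp hD
  have hb := primrec_bestCode hk hD
  refine Primrec.pair (primrec_two_pow hN) (Primrec.pair ?_ ?_)
  · exact Primrec.list_map (Primrec.list_range.comp hk)
      (primrec_gridWeight (hN.comp Primrec.fst) (hb.comp Primrec.fst) Primrec.snd)
  · refine Primrec.list_map (Primrec.list_range.comp (primrec_two_mul_sub_one hk)) ?_
    refine Primrec.list_map (Primrec.list_range.comp (hk.comp Primrec.fst)) ?_
    have h : Primrec fun p : ((ℕ × List (List ℕ)) × ℕ) × ℕ => p.1.1 :=
      Primrec.fst.comp Primrec.fst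
    exact primrec_gridMean (hN.comp h) (hk.comp h) (hb.comp h) (Primrec.snd.comp Primrec.fst)
      Primrec.snd

end Estimator

end MixProd

/-! ### Accuracy of the estimator, given accurate empirical moments. -/

namespace MixProd

open Finset

theorem abs_prod_sub_prod_le {ι : Type*} (S : Finset ι) {a b : ι → ℝ}
    (ha : ∀ i, a i ∈ Set.Icc (0 : ℝ) 1) (hb : ∀ i, b i ∈ Set.Icc (0 : ℝ) 1) :
    |∏ i ∈ S, a i - ∏ i ∈ S, b i| ≤ ∑ i ∈ S, |a i - b i| := by
  classical
  induction S using Finset.induction_on with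
  | empty => simp
  | insert i S hi ih =>
    rw [Finset.prod_insert hi, Finset.prod_insert hi, Finset.sum_insert hi]
    have e : a i * ∏ x ∈ S, a x - b i * ∏ x ∈ S, b x =
        (a i - b i) * ∏ x ∈ S, a x + b i * (∏ x ∈ S, a x - ∏ x ∈ S, b x) := by ring
    have h1 : |∏ x ∈ S, a x| ≤ 1 := by
      rw [Finset.abs_prod]
      exact Finset.prod_le_one (fun i _ => abs_nonneg _) fun i _ =>
        abs_le.2 ⟨by linarith [(ha i).1], (ha i).2⟩
    rw [e]
    refine (abs_add_le _ _).trans (add_le_add ?_ ?_)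
    · rw [abs_mul]
      exact mul_le_of_le_one_right (abs_nonneg _) h1
    · rw [abs_mul, abs_of_nonneg (hb i).1]
      exact (mul_le_of_le_one_left (abs_nonneg _) (hb i).2).trans ih

theorem prod_mem_Icc {ι : Type*} (S : Finset ι) {a : ι → ℝ} (ha : ∀ i, a i ∈ Set.Icc (0 : ℝ) 1) :
    ∏ i ∈ S, a i ∈ Set.Icc (0 : ℝ) 1 :=
  ⟨Finset.prod_nonneg fun i _ => (ha i).1,
    Finset.prod_le_one (fun i _ => (ha i).1) fun i _ => (ha i).2⟩

theorem sum_abs_sub_le_of_le {n : ℕ} (S : Finset (Fin n)) {a b : Fin n → ℝ} {e : ℝ} (he : 0 ≤ e)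
    (h : ∀ i, |a i - b i| ≤ e) : ∑ i ∈ S, |a i - b i| ≤ n * e := by
  refine (Finset.sum_le_sum fun i _ => h i).trans ?_
  rw [Finset.sum_const, nsmul_eq_mul]
  refine mul_le_mul_of_nonneg_right ?_ he
  exact_mod_cast (Finset.card_le_univ S).trans (by simp)

theorem abs_moment_sub_le {n k : ℕ} {θ θ' : Params n k} (hθ : θ ∈ models n k)
    (hθ' : θ' ∈ models n k) {e : ℝ} (he : 0 ≤ e) (hw : ∀ j, |θ.1 j - θ'.1 j| ≤ e)
    (hm : ∀ i j, |θ.2 i j - θ'.2 i j| ≤ e) (S : Finset (Fin n)) :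
    |moment θ.1 θ.2 S - moment θ'.1 θ'.2 S| ≤ (k + n) * e := by
  have e1 : moment θ.1 θ.2 S - moment θ'.1 θ'.2 S =
      ∑ j, (θ.1 j - θ'.1 j) * ∏ i ∈ S, θ.2 i j +
      ∑ j, θ'.1 j * (∏ i ∈ S, θ.2 i j - ∏ i ∈ S, θ'.2 i j) := by
    unfold moment
    rw [← Finset.sum_sub_distrib, ← Finset.sum_add_distrib]
    exact Finset.sum_congr rfl fun j _ => by ring
  rw [e1, add_mul]
  refine (abs_add_le _ _).trans (add_le_add ?_ ?_)
  · refine (Finset.abs_sum_le_sum_abs _ _).trans ?_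
    calc _ ≤ ∑ _j : Fin k, e := Finset.sum_le_sum fun j _ => by
          have h := prod_mem_Icc S fun i => hθ.2 i j
          rw [abs_mul, abs_of_nonneg h.1]
          exact (mul_le_of_le_one_right (abs_nonneg _) h.2).trans (hw j)
      _ = k * e := by simp
  · refine (Finset.abs_sum_le_sum_abs _ _).trans ?_
    calc _ ≤ ∑ j : Fin k, θ'.1 j * (n * e) := Finset.sum_le_sum fun j _ => by
          rw [abs_mul, abs_of_nonneg (hθ'.1.1 j)]
          refine mul_le_mul_of_nonneg_left ?_ (hθ'.1.1 j)
          exact (abs_prod_sub_prod_le S (fun i => hθ.2 i j) fun i => hθ'.2 i j).trans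
            (sum_abs_sub_le_of_le S he fun i => hm i j)
      _ = n * e := by rw [← Finset.sum_mul, hθ'.1.2, one_mul]

/-- The model with code `c`. -/
noncomputable def gridParams (N k c : ℕ) : Params (2 * k - 1) k :=
  (fun j => (gridWeight N c j : ℝ) / 2 ^ N, fun i j => (gridMean N k c i j : ℝ) / 2 ^ N)

theorem readParams_estimator (k : ℕ) (D : List (List ℕ)) :
    readParams (2 * k - 1) k (estimator (k, D)) = gridParams D.length k (bestCode k D) := by
  unfold readParams estimator gridParams
  ext1
  · funext j
    simp
  · funext i j
    have := i.2
    simp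

theorem cast_ndist (a b : ℕ) : (ndist a b : ℝ) = |(a : ℝ) - b| := by
  unfold ndist
  rcases le_total a b with h | h
  · rw [Nat.sub_eq_zero_of_le h, zero_add, Nat.cast_sub h, abs_sub_comm,
      abs_of_nonneg (sub_nonneg.2 (by exact_mod_cast h))]
  · rw [Nat.sub_eq_zero_of_le h, add_zero, Nat.cast_sub h,
      abs_of_nonneg (sub_nonneg.2 (by exact_mod_cast h))]

theorem gridParams_mem_models {N k c : ℕ} (h : weightGap N k c = 0) :
    gridParams N k c ∈ models (2 * k - 1) k := by
  have hQ : (0 : ℝ) < 2 ^ N := by positivity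
  refine ⟨⟨fun j => by simp only [gridParams]; positivity, ?_⟩, fun i j => ⟨?_, ?_⟩⟩
  · have h1 : ∑ j ∈ range k, gridWeight N c j = 2 ^ N := by
      unfold weightGap ndist at h; omega
    simp only [gridParams]
    rw [← Finset.sum_div, div_eq_one_iff_eq hQ.ne', Fin.sum_univ_eq_sum_range
      (fun j => (gridWeight N c j : ℝ)) k]
    exact_mod_cast h1
  · simp only [gridParams]; positivity
  · simp only [gridParams]
    rw [div_le_one hQ]
    have : gridMean N k c i j < 2 ^ N + 1 := digit_lt (by positivity) _ _
    exact_mod_cast Nat.lt_succ_iff.1 this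

/-- The set of observables with code `s`. -/
def digitSet (n s : ℕ) : Finset (Fin n) := univ.filter fun i => digit 2 s i = 1

theorem exists_digitSet_eq {n : ℕ} (S : Finset (Fin n)) : ∃ s < 2 ^ n, digitSet n s = S := by
  classical
  obtain ⟨s, hs, h⟩ := exists_digit_eq (b := 2) n
    (fun i => if h : i < n then (if (⟨i, h⟩ : Fin n) ∈ S then 1 else 0) else 0)
    (fun i hi => by simp only [hi, dite_true]; split_ifs <;> norm_num)
  refine ⟨s, hs, ?_⟩
  ext i
  simp [digitSet, h i i.2]

theorem cast_prod_digit {n : ℕ} (Q s : ℕ) (hQ : 0 < Q) (y : ℕ → ℕ) :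
    ((∏ i ∈ range n, (digit 2 s i * y i + (1 - digit 2 s i) * Q) : ℕ) : ℝ) =
      (Q : ℝ) ^ n * ∏ i ∈ digitSet n s, (y i : ℝ) / Q := by
  have hQ' : (Q : ℝ) ≠ 0 := by positivity
  rw [Finset.prod_range, Nat.cast_prod, digitSet, Finset.prod_filter]
  have : ((Q : ℝ) ^ n) = ∏ _i : Fin n, (Q : ℝ) := by simp
  rw [this, ← Finset.prod_mul_distrib]
  refine Finset.prod_congr rfl fun i _ => ?_
  have hd : digit 2 s i < 2 := digit_lt (by norm_num) _ _
  split_ifs with h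
  · rw [h]; field_simp; simp
  · have : digit 2 s i = 0 := by omega
    simp [this]

/-- The empirical moment of the digitized data `D`. -/
noncomputable def empMoment (n : ℕ) (D : List (List ℕ)) (S : Finset (Fin n)) : ℝ :=
  (∑ r ∈ range D.length, ∏ i ∈ S, (((D.getD r []).getD i 0 : ℕ) : ℝ) / 2 ^ D.length) / D.length

theorem cast_gridMoment (N k c s : ℕ) :
    (gridMoment N k c s : ℝ) = (2 ^ N) ^ (2 * k - 1) * 2 ^ N *
      moment (gridParams N k c).1 (gridParams N k c).2 (digitSet _ s) := by
  unfold gridMoment moment gridParams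
  rw [Finset.sum_range, Nat.cast_sum, Finset.mul_sum]
  refine Finset.sum_congr rfl fun j _ => ?_
  rw [Nat.cast_mul, cast_prod_digit (2 ^ N) s (by positivity) (fun i => gridMean N k c i j)]
  push_cast
  field_simp

theorem cast_dataMoment (k : ℕ) (D : List (List ℕ)) (hD : 0 < D.length) (s : ℕ) :
    (dataMoment k D s : ℝ) = D.length * (2 ^ D.length) ^ (2 * k - 1) *
      empMoment (2 * k - 1) D (digitSet (2 * k - 1) s) := by
  have hD' : (D.length : ℝ) ≠ 0 := by positivity
  unfold dataMoment empMoment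
  rw [Nat.cast_sum]
  simp only [cast_prod_digit (2 ^ D.length) s (by positivity)
    (fun i => (D.getD _ []).getD i 0)]
  rw [← Finset.mul_sum]
  push_cast
  field_simp

theorem cast_discrepancy (k : ℕ) (D : List (List ℕ)) (hD : 0 < D.length) (c : ℕ) :
    (discrepancy k D c : ℝ) = D.length * (2 ^ D.length) ^ (2 * k - 1) * 2 ^ D.length *
      ∑ s ∈ range (2 ^ (2 * k - 1)), |moment (gridParams D.length k c).1 (gridParams D.length k c).2
        (digitSet _ s) - empMoment (2 * k - 1) D (digitSet (2 * k - 1) s)| := by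
  unfold discrepancy
  rw [Nat.cast_sum, Finset.mul_sum]
  refine Finset.sum_congr rfl fun s _ => ?_
  rw [cast_ndist]
  push_cast
  rw [cast_gridMoment, cast_dataMoment _ _ hD]
  have h : (0 : ℝ) ≤ D.length * (2 ^ D.length) ^ (2 * k - 1) * 2 ^ D.length := by positivity
  conv_rhs => rw [← abs_of_nonneg h, ← abs_mul]
  congr 1
  ring

/-- A nonzero gap costs at least one more than the sum of all discrepancies, so it loses against any
code with gap zero. -/
theorem bestCode_spec (k : ℕ) (D : List (List ℕ)) {c : ℕ} (hc : c < numCodes D.length k)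
    (h0 : weightGap D.length k c = 0) :
    weightGap D.length k (bestCode k D) = 0 ∧
      discrepancy k D (bestCode k D) ≤ discrepancy k D c := by
  have h := (argminBelow_spec (score k D) hc).2
  change score k D (bestCode k D) ≤ score k D c at h
  have h1 : discrepancy k D c ≤ ∑ c' ∈ range (numCodes D.length k), discrepancy k D c' :=
    Finset.single_le_sum (f := discrepancy k D) (fun _ _ => Nat.zero_le _) (Finset.mem_range.2 hc)
  unfold score at h
  rw [h0, zero_mul, add_zero] at h
  have h2 : weightGap D.length k (bestCode k D) = 0 := by
    by_contra hne
    have := Nat.le_mul_of_pos_left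
      (1 + ∑ c' ∈ range (numCodes D.length k), discrepancy k D c') (Nat.pos_of_ne_zero hne)
    omega
  rw [h2, zero_mul, add_zero] at h
  exact ⟨h2, h⟩

/-- Rounding weights separately would spoil their sum. Instead the cumulative sums are rounded down
and differenced: the total telescopes to exactly `2 ^ N`, and each weight moves by at most one grid
step. The means are simply rounded down. -/
theorem exists_code {N k : ℕ} {θ : Params (2 * k - 1) k} (hθ : θ ∈ models (2 * k - 1) k) :
    ∃ c < numCodes N k, weightGap N k c = 0 ∧
      (∀ j, |θ.1 j - (gridParams N k c).1 j| ≤ 1 / 2 ^ N) ∧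
      ∀ i j, |θ.2 i j - (gridParams N k c).2 i j| ≤ 1 / 2 ^ N := by
  have hQ : (0 : ℝ) < 2 ^ N := by positivity
  set w : ℕ → ℝ := fun j => if h : j < k then θ.1 ⟨j, h⟩ else 0 with hw
  have hw0 : ∀ j, 0 ≤ w j := fun j => by
    simp only [hw]; split_ifs with h
    · exact hθ.1.1 _
    · exact le_rfl
  have hwsum : ∑ j ∈ range k, w j = 1 := by
    rw [← hθ.1.2, Finset.sum_range]
    exact Finset.sum_congr rfl fun j _ => by simp [hw]
  set A : ℕ → ℝ := fun j => 2 ^ N * ∑ i ∈ range j, w i with hA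
  have hA0 : ∀ j, 0 ≤ A j := fun j => mul_nonneg hQ.le (Finset.sum_nonneg fun i _ => hw0 i)
  have hAs : ∀ j, A (j + 1) = A j + 2 ^ N * w j := fun j => by
    simp only [hA]; rw [Finset.sum_range_succ, mul_add]
  have hAm : Monotone A := monotone_nat_of_le_succ fun j => by
    rw [hAs]; exact le_add_of_nonneg_right (mul_nonneg hQ.le (hw0 j))
  have hBm : Monotone fun j => ⌊A j⌋₊ := fun i j h => Nat.floor_mono (hAm h)
  have hAk : A k = 2 ^ N := by simp only [hA]; rw [hwsum, mul_one]
  set W : ℕ → ℕ := fun j => ⌊A (j + 1)⌋₊ - ⌊A j⌋₊ with hWdef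
  have hWsum : ∑ j ∈ range k, W j = 2 ^ N := by
    rw [hWdef, Finset.sum_range_tsub hBm, hAk]
    have : ((2 : ℝ) ^ N) = ((2 ^ N : ℕ) : ℝ) := by push_cast; rfl
    rw [this, Nat.floor_natCast]
    simp [hA]
  have hWle : ∀ j < k, W j ≤ 2 ^ N := fun j hj => by
    rw [← hWsum]
    exact Finset.single_le_sum (f := W) (fun _ _ => Nat.zero_le _) (Finset.mem_range.2 hj)
  have hk0 : ∀ i j : ℕ, j < k → (k + i * k + j - k) / k = i ∧ (k + i * k + j - k) % k = j := by
    intro i j hj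
    have e : k + i * k + j - k = j + k * i := by rw [mul_comm k i]; omega
    rw [e]
    exact ⟨by rw [Nat.add_mul_div_left _ _ (by omega), Nat.div_eq_of_lt hj, zero_add],
      by rw [Nat.add_mul_mod_self_left, Nat.mod_eq_of_lt hj]⟩
  set M : ℕ → ℕ → ℕ := fun i j => if h : i < 2 * k - 1 ∧ j < k then
    ⌊2 ^ N * θ.2 ⟨i, h.1⟩ ⟨j, h.2⟩⌋₊ else 0 with hM
  have hMle : ∀ i j, M i j ≤ 2 ^ N := fun i j => by
    simp only [hM]
    split_ifs with h
    · refine Nat.floor_le_of_le ?_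
      push_cast
      exact mul_le_of_le_one_right hQ.le (hθ.2 _ _).2
    · exact Nat.zero_le _
  obtain ⟨c, hc, hd⟩ := exists_digit_eq (b := 2 ^ N + 1) (k + (2 * k - 1) * k)
    (fun x => if x < k then W x else M ((x - k) / k) ((x - k) % k)) (fun x _ => by
      split_ifs with h
      · exact Nat.lt_succ_of_le (hWle x h)
      · exact Nat.lt_succ_of_le (hMle _ _))
  have hcW : ∀ j < k, gridWeight N c j = W j := fun j hj => by
    rw [gridWeight, hd j (by omega), if_pos hj]
  have hcM : ∀ i j, i < 2 * k - 1 → j < k → gridMean N k c i j = M i j := fun i j hi hj => by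
    have hlt : k + i * k + j < k + (2 * k - 1) * k := by
      have : (i + 1) * k ≤ (2 * k - 1) * k := Nat.mul_le_mul_right _ hi
      have e : (i + 1) * k = i * k + k := by ring
      omega
    rw [gridMean, hd _ hlt, if_neg (by omega), (hk0 i j hj).1, (hk0 i j hj).2]
  refine ⟨c, hc, ?_, fun j => ?_, fun i j => ?_⟩
  · unfold weightGap
    rw [Finset.sum_congr rfl fun j hj => hcW j (Finset.mem_range.1 hj), hWsum]
    simp [ndist]
  · simp only [gridParams]
    rw [hcW j j.2]
    have h1 := Nat.floor_le (hA0 j)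
    have h2 := Nat.lt_floor_add_one (A j)
    have h3 := Nat.floor_le (hA0 (j + 1))
    have h4 := Nat.lt_floor_add_one (A (j + 1))
    have h5 : (W j : ℝ) = ⌊A (j + 1)⌋₊ - ⌊A j⌋₊ := by
      simp only [hWdef]
      rw [Nat.cast_sub (hBm (Nat.le_succ _))]
    have h6 : w j = θ.1 j := by simp [hw]
    have h7 := hAs j
    rw [h6] at h7
    have e : θ.1 j - (W j : ℝ) / 2 ^ N = (2 ^ N * θ.1 j - W j) / 2 ^ N := by field_simp
    rw [e, abs_div, abs_of_pos hQ]
    refine div_le_div_of_nonneg_right ?_ hQ.le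
    rw [abs_le]
    constructor <;> linarith
  · simp only [gridParams]
    rw [hcM i j i.2 j.2]
    have h5 : M i j = ⌊2 ^ N * θ.2 i j⌋₊ := by simp [hM]
    have h1 := Nat.floor_le (mul_nonneg hQ.le (hθ.2 i j).1)
    have h2 := Nat.lt_floor_add_one (2 ^ N * θ.2 i j)
    have e : θ.2 i j - (M i j : ℝ) / 2 ^ N = (2 ^ N * θ.2 i j - M i j) / 2 ^ N := by field_simp
    rw [e, abs_div, abs_of_pos hQ]
    refine div_le_div_of_nonneg_right ?_ hQ.le
    rw [h5, abs_le]
    constructor <;> linarith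

/-- This needs no good event: the grid always contains a genuine model, for instance a rounded point
mass, and the penalty then excludes all invalid codes. -/
theorem readParams_estimator_mem_models {k : ℕ} (hk : 1 ≤ k) (D : List (List ℕ)) :
    readParams (2 * k - 1) k (estimator (k, D)) ∈ models (2 * k - 1) k := by
  have : Nonempty (Fin k) := ⟨⟨0, hk⟩⟩
  have hθ : ((Pi.single ⟨0, hk⟩ 1, fun _ _ => 0) : Params (2 * k - 1) k) ∈
      models (2 * k - 1) k := ⟨single_mem_stdSimplex ℝ _, by simp⟩
  obtain ⟨c, hc, h0, -⟩ := exists_code (N := D.length) hθ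
  rw [readParams_estimator]
  exact gridParams_mem_models (bestCode_spec k D hc h0).1

/-- If the empirical moments are close to those of a model, so are the moments of the estimate. -/
theorem abs_moment_estimator_sub_le {k : ℕ} {D : List (List ℕ)} (hD : 0 < D.length)
    {θ : Params (2 * k - 1) k} (hθ : θ ∈ models (2 * k - 1) k) {h : ℝ}
    (hemp : ∀ S, |empMoment _ D S - moment θ.1 θ.2 S| ≤ h) (S : Finset (Fin (2 * k - 1))) :
    |moment θ.1 θ.2 S - moment (readParams (2 * k - 1) k (estimator (k, D))).1
      (readParams (2 * k - 1) k (estimator (k, D))).2 S| ≤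
      2 ^ (2 * k - 1) * ((k + (2 * k - 1 : ℕ)) * (1 / 2 ^ D.length) + h) + h := by
  obtain ⟨c, hc, h0, hcw, hcm⟩ := exists_code (N := D.length) hθ
  rw [readParams_estimator]
  obtain ⟨-, hle⟩ := bestCode_spec k D hc h0
  have hle' : (discrepancy k D (bestCode k D) : ℝ) ≤ discrepancy k D c := by exact_mod_cast hle
  have hpos : (0 : ℝ) < D.length * (2 ^ D.length) ^ (2 * k - 1) * 2 ^ D.length := by positivity
  rw [cast_discrepancy _ _ hD, cast_discrepancy _ _ hD, mul_le_mul_iff_right₀ hpos] at hle'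
  -- The rounded truth competes in the search, so its total discrepancy bounds that of the winner,
  -- and hence each single term of the latter.
  have hc' : ∑ s ∈ range (2 ^ (2 * k - 1)), |moment (gridParams D.length k c).1
      (gridParams D.length k c).2 (digitSet _ s) - empMoment (2 * k - 1) D (digitSet (2 * k - 1) s)| ≤
      2 ^ (2 * k - 1) * ((k + (2 * k - 1 : ℕ)) * (1 / 2 ^ D.length) + h) := by
    refine (Finset.sum_le_card_nsmul _ _ _ fun s _ => ?_).trans
      (le_of_eq (by rw [nsmul_eq_mul, Finset.card_range, Nat.cast_pow, Nat.cast_ofNat]))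
    have h1 := abs_moment_sub_le hθ (gridParams_mem_models h0) (by positivity) hcw hcm
      (digitSet (2 * k - 1) s)
    have h2 := hemp (digitSet (2 * k - 1) s)
    rw [abs_sub_comm] at h1 h2
    exact (abs_sub_le _ _ _).trans (add_le_add h1 h2)
  obtain ⟨s, hs, rfl⟩ := exists_digitSet_eq S
  have h1 := Finset.single_le_sum (f := fun s => |moment (gridParams D.length k (bestCode k D)).1
      (gridParams D.length k (bestCode k D)).2 (digitSet (2 * k - 1) s) -
      empMoment (2 * k - 1) D (digitSet (2 * k - 1) s)|) (fun _ _ => abs_nonneg _) (Finset.mem_range.2 hs)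
  have h2 := hemp (digitSet (2 * k - 1) s)
  rw [abs_sub_comm]
  exact (abs_sub_le _ _ _).trans (add_le_add ((h1.trans hle').trans hc') h2)

theorem length_digitize {n N : ℕ} (X : Fin N → Fin n → ℝ) : (digitize X).length = N := by
  simp [digitize]

theorem abs_empMoment_digitize_sub_le {n N : ℕ} (hN : 0 < N) {X : Fin N → Fin n → ℝ}
    (hX : ∀ s i, X s i ∈ Set.Icc (0 : ℝ) 1) (S : Finset (Fin n)) :
    |empMoment n (digitize X) S - (∑ s, ∏ i ∈ S, X s i) / N| ≤ n * (1 / 2 ^ N) := by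
  have hQ : (0 : ℝ) < 2 ^ N := by positivity
  have hN' : (0 : ℝ) < N := by exact_mod_cast hN
  have e : empMoment n (digitize X) S =
      (∑ s : Fin N, ∏ i ∈ S, (⌊2 ^ N * X s i⌋₊ : ℝ) / 2 ^ N) / N := by
    unfold empMoment
    rw [length_digitize, Finset.sum_range]
    simp [digitize]
  rw [e, ← sub_div, abs_div, abs_of_pos hN', div_le_iff₀ hN', ← Finset.sum_sub_distrib]
  refine (Finset.abs_sum_le_sum_abs _ _).trans ?_
  refine (Finset.sum_le_card_nsmul (univ : Finset (Fin N)) _ ((n : ℝ) * (1 / 2 ^ N)) fun s _ => ?_).trans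
    (le_of_eq (by rw [nsmul_eq_mul, Finset.card_univ, Fintype.card_fin, mul_comm]))
  have hfl : ∀ i, (⌊2 ^ N * X s i⌋₊ : ℝ) ≤ 2 ^ N * X s i := fun i =>
    Nat.floor_le (mul_nonneg hQ.le (hX s i).1)
  refine (abs_prod_sub_prod_le S (fun i => ⟨by positivity, ?_⟩) (hX s)).trans
    (sum_abs_sub_le_of_le S (by positivity) fun i => ?_)
  · rw [div_le_one hQ]
    exact (hfl i).trans (mul_le_of_le_one_right hQ.le (hX s i).2)
  · have e : (⌊2 ^ N * X s i⌋₊ : ℝ) / 2 ^ N - X s i = (⌊2 ^ N * X s i⌋₊ - 2 ^ N * X s i) / 2 ^ N := by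
      field_simp
    rw [e, abs_div, abs_of_pos hQ]
    refine div_le_div_of_nonneg_right ?_ hQ.le
    have := Nat.lt_floor_add_one (2 ^ N * X s i)
    rw [abs_le]
    constructor <;> linarith [hfl i]

end MixProd

/-! ### Moments of the sampled law and their concentration. -/

namespace MixProd

open Finset MeasureTheory ProbabilityTheory

section Law

variable {n k : ℕ} {θ : Params n k} {P : Measure (Fin n → ℝ)}

theorem IsMixtureLaw.isProbabilityMeasure (h : IsMixtureLaw θ P) (hθ : θ ∈ models n k) :
    IsProbabilityMeasure P := by
  obtain ⟨ν, hν, -, -, rfl⟩ := h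
  constructor
  simp only [Measure.finsetSum_apply, Measure.smul_apply, measure_univ, smul_eq_mul, mul_one]
  rw [← ENNReal.ofReal_sum_of_nonneg fun j _ => hθ.1.1 j, hθ.1.2, ENNReal.ofReal_one]

theorem ae_pi_mem_Icc {ν : Fin n → Measure ℝ} [∀ i, IsProbabilityMeasure (ν i)]
    (h : ∀ i, ∀ᵐ x ∂(ν i), x ∈ Set.Icc (0 : ℝ) 1) :
    ∀ᵐ x ∂(Measure.pi ν), ∀ i, x i ∈ Set.Icc (0 : ℝ) 1 :=
  ae_all_iff.2 fun i => (measurePreserving_eval ν i).quasiMeasurePreserving.ae (h i)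

theorem IsMixtureLaw.ae_mem_Icc (h : IsMixtureLaw θ P) :
    ∀ᵐ x ∂P, ∀ i, x i ∈ Set.Icc (0 : ℝ) 1 := by
  obtain ⟨ν, hν, h01, -, rfl⟩ := h
  rw [ae_iff]
  simp only [Measure.finsetSum_apply, Measure.smul_apply, smul_eq_mul]
  refine Finset.sum_eq_zero fun j _ => ?_
  have := ae_pi_mem_Icc fun i => h01 i j
  rw [ae_iff] at this
  rw [this, mul_zero]

theorem measurable_prod_eval (S : Finset (Fin n)) :
    Measurable fun x : Fin n → ℝ => ∏ i ∈ S, x i :=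
  Finset.measurable_fun_prod _ fun i _ => measurable_pi_apply i

theorem IsMixtureLaw.integral_prod (h : IsMixtureLaw θ P) (hθ : θ ∈ models n k)
    (S : Finset (Fin n)) : ∫ x, ∏ i ∈ S, x i ∂P = moment θ.1 θ.2 S := by
  classical
  obtain ⟨ν, hν, h01, hmean, rfl⟩ := h
  have hint : ∀ j, Integrable (fun x : Fin n → ℝ => ∏ i ∈ S, x i)
      (Measure.pi fun i => ν i j) := fun j =>
    Integrable.of_mem_Icc 0 1 (measurable_prod_eval S).aemeasurable
      ((ae_pi_mem_Icc fun i => h01 i j).mono fun x hx => prod_mem_Icc S hx)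
  rw [integral_finsetSum_measure fun j _ => (hint j).smul_measure ENNReal.ofReal_ne_top]
  unfold moment
  refine Finset.sum_congr rfl fun j _ => ?_
  rw [integral_smul_measure, ENNReal.toReal_ofReal (hθ.1.1 j), smul_eq_mul]
  congr 1
  -- Extended by factors `1` outside `S`, the product runs over all observables and conditional
  -- independence applies.
  have h1 := integral_fintype_prod_eq_prod (𝕜 := ℝ) (fun (i : Fin n) (x : ℝ) => if i ∈ S then x else 1)
    (μ := fun i => ν i j)
  simp only [Finset.prod_ite_mem, Finset.univ_inter] at h1
  rw [h1, ← Finset.prod_subset (Finset.subset_univ S)]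
  · exact Finset.prod_congr rfl fun i hi => by simp [hi, hmean]
  · intro i _ hi; simp [hi]

end Law

/-- Hoeffding's inequality for the average of a function of `N` independent samples. -/
theorem sampleLaw_real_abs_average_sub_ge_le {n N : ℕ} (hN : 0 < N) (P : Measure (Fin n → ℝ))
    [IsProbabilityMeasure P] {f : (Fin n → ℝ) → ℝ} (hf : Measurable f)
    (h01 : ∀ᵐ x ∂P, f x ∈ Set.Icc (0 : ℝ) 1) {h : ℝ} (hh : 0 ≤ h) :
    (sampleLaw N P).real {X | h ≤ |(∑ s, f (X s)) / N - ∫ x, f x ∂P|} ≤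
      2 * Real.exp (-(2 * N * h ^ 2)) := by
  have hN' : (0 : ℝ) < N := by exact_mod_cast hN
  set c := ∫ x, f x ∂P with hc
  have hprob : IsProbabilityMeasure (sampleLaw N P) := by unfold sampleLaw; infer_instance
  have hmp : ∀ s : Fin N, MeasurePreserving (Function.eval s) (sampleLaw N P) P := fun s =>
    measurePreserving_eval (fun _ : Fin N => P) s
  have hmean : ∀ s : Fin N, ∫ X, f (X s) ∂(sampleLaw N P) = c := fun s => by
    have := integral_map (μ := sampleLaw N P) (f := f) (hmp s).measurable.aemeasurable hf.aestronglyMeasurable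
    rw [(hmp s).map_eq] at this
    exact this.symm
  have hsub : ∀ s : Fin N, HasSubgaussianMGF (fun X : Fin N → Fin n → ℝ => f (X s) - c)
      ((‖(1 : ℝ) - 0‖₊ / 2) ^ 2) (sampleLaw N P) := fun s => by
    have := hasSubgaussianMGF_of_mem_Icc (μ := sampleLaw N P) (a := 0) (b := 1)
      (X := fun X => f (X s)) (hf.comp (hmp s).measurable).aemeasurable
      ((hmp s).quasiMeasurePreserving.ae h01)
    rwa [hmean s] at this
  have hind : iIndepFun (fun (s : Fin N) (X : Fin N → Fin n → ℝ) => f (X s) - c)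
      (sampleLaw N P) :=
    iIndepFun_pi (μ := fun _ : Fin N => P) (X := fun _ x => f x - c)
      fun _ => (hf.sub_const c).aemeasurable
  have hind' : iIndepFun (fun (s : Fin N) (X : Fin N → Fin n → ℝ) => -(f (X s) - c))
      (sampleLaw N P) :=
    iIndepFun_pi (μ := fun _ : Fin N => P) (X := fun _ x => -(f x - c))
      fun _ => (hf.sub_const c).neg.aemeasurable
  -- A variable with values in `[0,1]` has variance proxy `1/4`.
  have hexp : -(N * h) ^ 2 / (2 * ((∑ _s : Fin N, (‖(1 : ℝ) - 0‖₊ / 2) ^ 2 : NNReal) : ℝ)) =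
      -(2 * N * h ^ 2) := by
    simp only [sub_zero, nnnorm_one, Finset.sum_const, Finset.card_univ, Fintype.card_fin,
      nsmul_eq_mul]
    push_cast
    field_simp
  have b1 := HasSubgaussianMGF.measure_sum_ge_le_of_iIndepFun hind (s := univ)
    (fun s _ => hsub s) (ε := N * h) (by positivity)
  have b2 := HasSubgaussianMGF.measure_sum_ge_le_of_iIndepFun hind' (s := univ)
    (fun s _ => (hsub s).neg) (ε := N * h) (by positivity)
  rw [hexp] at b1 b2
  rw [two_mul (Real.exp _)]
  refine le_trans (measureReal_mono ?_) ((measureReal_union_le _ _).trans (add_le_add b1 b2))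
  intro X hX
  simp only [Set.mem_union, Set.mem_ofPred_eq] at hX ⊢
  have e : (∑ s, f (X s)) / N - c = (∑ s, (f (X s) - c)) / N := by
    rw [Finset.sum_sub_distrib]
    simp
    field_simp
  rw [e, abs_div, abs_of_pos hN', le_div_iff₀ hN', mul_comm] at hX
  rw [Finset.sum_neg_distrib]
  exact le_abs.1 hX

/-- With high probability all data lie in `[0,1]` and all empirical moments of the data are close
to the moments of the model. -/
theorem IsMixtureLaw.sampleLaw_real_ge {n k N : ℕ} (hN : 0 < N) {θ : Params n k}
    {P : Measure (Fin n → ℝ)} (hP : IsMixtureLaw θ P) (hθ : θ ∈ models n k) {h : ℝ} (hh : 0 ≤ h) :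
    1 - 2 ^ n * (2 * Real.exp (-(2 * N * h ^ 2))) ≤ (sampleLaw N P).real
      {X | (∀ s i, X s i ∈ Set.Icc (0 : ℝ) 1) ∧
        ∀ S, |(∑ s, ∏ i ∈ S, X s i) / N - moment θ.1 θ.2 S| < h} := by
  have hprobP := hP.isProbabilityMeasure hθ
  have hprob : IsProbabilityMeasure (sampleLaw N P) := by unfold sampleLaw; infer_instance
  set B : Finset (Fin n) → Set (Fin N → Fin n → ℝ) := fun S =>
    {X | h ≤ |(∑ s, ∏ i ∈ S, X s i) / N - moment θ.1 θ.2 S|} with hB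
  have hBm : ∀ S, MeasurableSet (B S) := fun S => by
    refine measurableSet_le measurable_const (Measurable.abs (Measurable.sub_const
      (Measurable.div_const (Finset.measurable_fun_sum _ fun s _ => ?_) _) _))
    exact (measurable_prod_eval S).comp (measurable_pi_apply s)
  have hU : (sampleLaw N P).real (⋃ S, B S) ≤ 2 ^ n * (2 * Real.exp (-(2 * N * h ^ 2))) := by
    refine (measureReal_iUnion_fintype_le _).trans ?_
    refine (Finset.sum_le_card_nsmul univ _ _ fun S _ => ?_).trans
      (le_of_eq (by rw [nsmul_eq_mul, Finset.card_univ, Fintype.card_finset, Fintype.card_fin,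
        Nat.cast_pow, Nat.cast_ofNat]))
    have := sampleLaw_real_abs_average_sub_ge_le hN P (measurable_prod_eval S)
      (hP.ae_mem_Icc.mono fun x hx => prod_mem_Icc S hx) hh
    rwa [hP.integral_prod hθ S] at this
  have hae : ∀ᵐ X ∂(sampleLaw N P), ∀ s i, X s i ∈ Set.Icc (0 : ℝ) 1 :=
    ae_all_iff.2 fun s => (measurePreserving_eval (fun _ : Fin N => P)
      s).quasiMeasurePreserving.ae hP.ae_mem_Icc
  have hcompl := probReal_compl_eq_one_sub (μ := sampleLaw N P) (MeasurableSet.iUnion hBm)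
  have heq : (sampleLaw N P).real {X | (∀ s i, X s i ∈ Set.Icc (0 : ℝ) 1) ∧
      ∀ S, |(∑ s, ∏ i ∈ S, X s i) / N - moment θ.1 θ.2 S| < h} =
      (sampleLaw N P).real (⋃ S, B S)ᶜ := by
    refine measureReal_congr ?_
    filter_upwards [hae] with X hX
    refine propext ?_
    change (_ ∧ _) ↔ X ∈ (⋃ S, B S)ᶜ
    simp only [hB, Set.mem_compl_iff, Set.mem_iUnion, Set.mem_ofPred_eq, not_exists, not_le]
    exact ⟨fun h => h.2, fun h => ⟨hX, h⟩⟩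
  rw [heq, hcompl]
  linarith

end MixProd

/-! ### From stability and concentration to the sample size. -/

namespace MixProd

open Finset MeasureTheory

theorem modelDist_le {n k : ℕ} (hn : 0 < n) (hk : 0 < k) {θ θ' : Params n k} {K : ℝ}
    (ρ : Equiv.Perm (Fin k)) (hw : ∀ j, |θ.1 j - θ'.1 (ρ j)| ≤ K)
    (hm : ∀ j i, |θ.2 i j - θ'.2 i (ρ j)| ≤ K) : modelDist θ θ' ≤ K := by
  have : Nonempty (Fin n) := ⟨⟨0, hn⟩⟩
  have : Nonempty (Fin k) := ⟨⟨0, hk⟩⟩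
  exact (ciInf_le (Set.finite_range _).bddBelow ρ).trans
    (max_le (ciSup_le hw) (ciSup_le fun i => ciSup_le fun j => hm j i))

theorem modelDist_le_one {n k : ℕ} (hn : 0 < n) (hk : 0 < k) {θ θ' : Params n k}
    (hθ : θ ∈ models n k) (hθ' : θ' ∈ models n k) : modelDist θ θ' ≤ 1 := by
  have hle : ∀ {θ : Params n k}, θ ∈ models n k → ∀ j, θ.1 j ≤ 1 := fun {θ} hθ j => by
    rw [← hθ.1.2]
    exact Finset.single_le_sum (fun j _ => hθ.1.1 j) (Finset.mem_univ _)
  refine modelDist_le hn hk (Equiv.refl _) (fun j => ?_) fun j i => ?_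
  · exact abs_le.2 ⟨by linarith [hθ.1.1 j, hle hθ' (Equiv.refl _ j)],
      by linarith [hle hθ j, hθ'.1.1 (Equiv.refl _ j)]⟩
  · exact abs_le.2 ⟨by linarith [(hθ.2 i j).1, (hθ'.2 i (Equiv.refl _ j)).2],
      by linarith [(hθ.2 i j).2, (hθ'.2 i (Equiv.refl _ j)).1]⟩

/-- Stability: a model whose moments are close to those of a separated model is close to it. -/
theorem modelDist_le_of_moment {k : ℕ} (hk : 1 ≤ k) {ζ p η : ℝ} (hζ : 0 < ζ) (hζ1 : ζ ≤ 1)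
    (hp : 0 < p) {θ θ' : Params (2 * k - 1) k} (hθ : θ ∈ separatedModels (2 * k - 1) k ζ p)
    (hθ' : θ' ∈ models (2 * k - 1) k)
    (h : ∀ S, |moment θ.1 θ.2 S - moment θ'.1 θ'.2 S| ≤ η)
    (hη : 25 * (k * (2 / ζ) ^ (4 * k) * η / p ^ 2) ≤ 1) :
    modelDist θ θ' ≤ 25 * (k * (2 / ζ) ^ (4 * k) * η / p ^ 2) := by
  obtain ⟨t, rfl⟩ : ∃ t, k = t + 1 := ⟨k - 1, by omega⟩
  have hη0 : 0 ≤ η := (abs_nonneg _).trans (h ∅)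
  obtain ⟨⟨⟨hw0, hwsum⟩, h01⟩, hw, hm⟩ := hθ
  obtain ⟨⟨hw0', hwsum'⟩, h01'⟩ := hθ'
  -- Any splitting of the observables will do, since every one of them is separated.
  let e : (Fin t ⊕ Fin t) ⊕ Unit ≃ Fin (2 * (t + 1) - 1) :=
    Fintype.equivOfCardEq (by simp; omega)
  have hΛ : 1 ≤ 2 / ζ := by rw [le_div_iff₀ hζ]; linarith
  have hK : 25 * (((t + 1 : ℕ) : ℝ) * (2 / ζ) * ((2 / ζ) ^ t) ^ 4 * η / p ^ 2) ≤
      25 * (((t + 1 : ℕ) : ℝ) * (2 / ζ) ^ (4 * (t + 1)) * η / p ^ 2) := by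
    have : (2 / ζ) * ((2 / ζ) ^ t) ^ 4 ≤ (2 / ζ) ^ (4 * (t + 1)) := by
      rw [← pow_mul, ← pow_succ']
      exact pow_le_pow_right₀ hΛ (by omega)
    rw [mul_assoc ((t + 1 : ℕ) : ℝ)]
    gcongr
  obtain ⟨ρ, hρ⟩ := exists_perm_close_of_affineMoment (m := fun i => θ.2 (e i))
    (m' := fun i => θ'.2 (e i)) hζ hζ1 hp hw hwsum hw0' hwsum' (fun i => h01 _) (fun i => h01' _)
    (fun i => hm _) (η := η) (fun α β => by
      rw [affineMoment_comp_equiv, affineMoment_comp_equiv]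
      refine (abs_affineMoment_sub_le h _ _).trans (le_of_eq ?_)
      rw [Equiv.prod_comp e.symm fun i => |α i| + |β i|]) rfl (hK.trans hη)
  refine (modelDist_le (by omega) (by omega) ρ (fun j => (hρ j).1) fun j i => ?_).trans hK
  have := (hρ j).2 (e.symm i)
  rwa [Equiv.apply_symm_apply] at this

/-- Three `ζ`-separated numbers in `[0,1]` force `ζ ≤ 1/2`; for `k ≤ 2` the factor `4` suffices. -/
theorem two_pow_le_of_separated {k : ℕ} (hk : 1 ≤ k) {ζ p : ℝ} (hζ : 0 < ζ) (hζ1 : ζ ≤ 1)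
    {θ : Params (2 * k - 1) k} (hθ : θ ∈ separatedModels (2 * k - 1) k ζ p) :
    (2 : ℝ) ^ k ≤ 4 * (1 / ζ) ^ k := by
  have hz : 1 ≤ 1 / ζ := by rw [le_div_iff₀ hζ]; linarith
  rcases Nat.lt_or_ge k 3 with h | h
  · have h1 : (2 : ℝ) ^ k ≤ 2 ^ 2 := pow_le_pow_right₀ (by norm_num) (by omega)
    have h2 : 1 ≤ (1 / ζ) ^ k := one_le_pow₀ hz
    linarith
  · obtain ⟨⟨-, h01⟩, -, hm⟩ := hθ
    have hi : 0 < 2 * k - 1 := by omega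
    have a := hm ⟨0, hi⟩ ⟨0, by omega⟩ ⟨1, by omega⟩ (by simp)
    have b := hm ⟨0, hi⟩ ⟨0, by omega⟩ ⟨2, by omega⟩ (by simp)
    have c := hm ⟨0, hi⟩ ⟨1, by omega⟩ ⟨2, by omega⟩ (by simp)
    have ha := h01 ⟨0, hi⟩ ⟨0, by omega⟩
    have hb := h01 ⟨0, hi⟩ ⟨1, by omega⟩
    have hc := h01 ⟨0, hi⟩ ⟨2, by omega⟩
    rw [Set.mem_Icc] at ha hb hc
    have hζ2 : ζ ≤ 1 / 2 := by
      rcases le_abs.1 a with a | a <;> rcases le_abs.1 b with b | b <;>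
        rcases le_abs.1 c with c | c <;> linarith
    have hz2 : 2 ≤ 1 / ζ := by rw [le_div_iff₀ hζ]; linarith
    have := pow_le_pow_left₀ (by norm_num) hz2 k
    have h0 : (0 : ℝ) ≤ (1 / ζ) ^ k := by positivity
    linarith

/-- Bounding `k` by `2^k` leaves `15000 * (2^k)^15 * (z^k)^8 * q^4`; trading each `2^k` for `4 *
z^k` gives `z^(23k)` and the constant `15000 * 4^15 < 2^44`. -/
theorem sample_bound {C k : ℕ} (hC : 2 ^ 44 ≤ C) (hk : 1 ≤ k) {z q : ℝ} (hz : 1 ≤ z) (hq : 1 ≤ q)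
    (h : (2 : ℝ) ^ k ≤ 4 * z ^ k) :
    24 * k * 16 ^ k * (25 * (k * (2 * z) ^ (4 * k) * q ^ 2)) ^ 2 ≤ C * z ^ (C * k) * q ^ C := by
  have hC' : (2 : ℝ) ^ 44 ≤ C := by exact_mod_cast hC
  have h23 : 23 ≤ C := le_trans (by norm_num) hC
  have hkk : (k : ℝ) ≤ 2 ^ k := by exact_mod_cast Nat.lt_two_pow_self.le
  have hz0 : 0 ≤ z := by linarith
  have hq0 : 0 ≤ q := by linarith
  calc 24 * k * 16 ^ k * (25 * (k * (2 * z) ^ (4 * k) * q ^ 2)) ^ 2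
      = 15000 * (k : ℝ) ^ 3 * ((2 : ℝ) ^ k) ^ 12 * (z ^ k) ^ 8 * q ^ 4 := by
        have e : (16 : ℝ) ^ k = ((2 : ℝ) ^ k) ^ 4 := by
          rw [← pow_mul, mul_comm, pow_mul]; norm_num
        have e2 : (2 * z) ^ (4 * k) = ((2 : ℝ) ^ k) ^ 4 * (z ^ k) ^ 4 := by
          rw [mul_comm 4 k, pow_mul, mul_pow, mul_pow]
        rw [e, e2]; ring
    _ ≤ 15000 * ((2 : ℝ) ^ k) ^ 3 * ((2 : ℝ) ^ k) ^ 12 * (z ^ k) ^ 8 * q ^ 4 := by gcongr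
    _ = 15000 * ((2 : ℝ) ^ k) ^ 15 * (z ^ k) ^ 8 * q ^ 4 := by ring
    _ ≤ 15000 * (4 * z ^ k) ^ 15 * (z ^ k) ^ 8 * q ^ 4 := by gcongr
    _ = 15000 * 4 ^ 15 * (z ^ (23 * k)) * q ^ 4 := by
        rw [mul_comm 23 k, pow_mul]; ring
    _ ≤ C * z ^ (C * k) * q ^ C := by
        gcongr
        · refine le_trans ?_ hC'; norm_num
        · omega

theorem abs_moment_estimator_digitize_sub_le {k N : ℕ} (hk : 1 ≤ k) (hN : 0 < N)
    {θ : Params (2 * k - 1) k} (hθ : θ ∈ models (2 * k - 1) k) {X : Fin N → Fin (2 * k - 1) → ℝ}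
    (hX : ∀ s i, X s i ∈ Set.Icc (0 : ℝ) 1) {h : ℝ}
    (hemp : ∀ S, |(∑ s, ∏ i ∈ S, X s i) / N - moment θ.1 θ.2 S| < h)
    (S : Finset (Fin (2 * k - 1))) :
    |moment θ.1 θ.2 S - moment (readParams (2 * k - 1) k (estimator (k, digitize X))).1
      (readParams (2 * k - 1) k (estimator (k, digitize X))).2 S| ≤
      4 ^ k * (h + 5 * k / 2 ^ N) := by
  have h1 : ∀ S, |empMoment _ (digitize X) S - moment θ.1 θ.2 S| ≤
      (2 * k - 1 : ℕ) * (1 / 2 ^ N) + h := fun S =>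
    (abs_sub_le _ _ _).trans
      (add_le_add (abs_empMoment_digitize_sub_le hN hX S) (hemp S).le)
  refine (abs_moment_estimator_sub_le (by rwa [length_digitize]) hθ h1 S).trans ?_
  rw [length_digitize]
  have hh : 0 ≤ h := (abs_nonneg _).trans (hemp ∅).le
  have hn : ((2 * k - 1 : ℕ) : ℝ) ≤ 2 * k := by exact_mod_cast Nat.sub_le _ _
  have h4 : (4 : ℝ) ^ k = 2 * 2 ^ (2 * k - 1) := by
    rw [← pow_succ', show 2 * k - 1 + 1 = 2 * k by omega, pow_mul]; norm_num
  have hu : (0 : ℝ) ≤ 1 / 2 ^ N := by positivity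
  have e5 : (5 * k / 2 ^ N : ℝ) = 5 * k * (1 / 2 ^ N) := by ring
  rw [h4, e5]
  have hone : (1 : ℝ) ≤ 2 ^ (2 * k - 1) := one_le_pow₀ (by norm_num)
  generalize ((2 * k - 1 : ℕ) : ℝ) = n at *
  generalize (2 : ℝ) ^ (2 * k - 1) = A at *
  generalize (1 / 2 ^ N : ℝ) = u at *
  have hk0 : (0 : ℝ) ≤ k := by positivity
  have hnu : n * u ≤ 2 * k * u := mul_le_mul_of_nonneg_right hn hu
  have hku : 0 ≤ k * u := by positivity
  calc A * ((k + n) * u + (n * u + h)) + (n * u + h)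
      ≤ A * ((k + n) * u + (n * u + h)) + A * (2 * k * u + h) := by
        gcongr
        exact (add_le_add hnu le_rfl).trans (le_mul_of_one_le_left (by positivity) hone)
    _ = A * (k * u + 2 * (n * u) + 2 * k * u + 2 * h) := by ring
    _ ≤ A * (k * u + 2 * (2 * k * u) + 2 * k * u + 2 * h) := by gcongr
    _ ≤ A * (10 * k * u + 2 * h) := by
        refine mul_le_mul_of_nonneg_left ?_ (by linarith)
        linarith
    _ = 2 * A * (h + 5 * k * u) := by ring

/-- The failure probability of the empirical moments is at most `δ`. -/
theorem four_pow_mul_exp_le {k : ℕ} (hk : 1 ≤ k) {N δ h : ℝ} (hδ : 0 < δ) (hδ2 : δ ≤ 1 / 2)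
    (hN : 3 * k * Real.log (1 / δ) ≤ 2 * N * h ^ 2) :
    2 ^ (2 * k - 1) * (2 * Real.exp (-(2 * N * h ^ 2))) ≤ δ := by
  have h4 : (2 : ℝ) ^ (2 * k - 1) * 2 = 2 ^ (2 * k) := by
    rw [← pow_succ, show 2 * k - 1 + 1 = 2 * k by omega]
  have hl2 : Real.log 2 ≤ Real.log (1 / δ) :=
    Real.log_le_log (by norm_num) (by rw [le_div_iff₀ hδ]; linarith)
  have hl0 : 0 < Real.log 2 := Real.log_pos (by norm_num)
  have hk' : (1 : ℝ) ≤ k := by exact_mod_cast hk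
  rw [← mul_assoc, h4]
  have e1 : (2 : ℝ) ^ (2 * k) = Real.exp (2 * k * Real.log 2) := by
    rw [← Real.rpow_natCast, Real.rpow_def_of_pos (by norm_num)]
    push_cast; ring_nf
  have e2 : δ = Real.exp (-Real.log (1 / δ)) := by
    rw [one_div, Real.log_inv, neg_neg, Real.exp_log hδ]
  conv_rhs => rw [e2]
  rw [e1, ← Real.exp_add, Real.exp_le_exp]
  -- Of `3k log (1/δ)`, the part `2k log (1/δ)` pays for `4^k` because `δ ≤ 1/2`, and the remaining
  -- `k log (1/δ)` gives `δ`.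
  nlinarith [mul_le_mul_of_nonneg_left hl2 (by linarith : (0 : ℝ) ≤ 2 * k)]

theorem estimator_succeeds {C : ℕ} (hC : 2 ^ 44 ≤ C) {k : ℕ} {ζ p ε δ : ℝ} (hk : 1 ≤ k)
    (hζ : 0 < ζ) (hζ1 : ζ ≤ 1) (hp : 0 < p) (hε : 0 < ε) (hδ : 0 < δ) (hδ2 : δ ≤ 1 / 2) {N : ℕ}
    (hN : (C : ℝ) * (1 / ζ) ^ (C * k) * (1 / p) ^ C * (1 / ε) ^ 2 * Real.log (1 / δ) ≤ N)
    {θ : Params (2 * k - 1) k} (hθ : θ ∈ separatedModels (2 * k - 1) k ζ p)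
    {P : Measure (Fin (2 * k - 1) → ℝ)} (hP : IsMixtureLaw θ P) :
    1 - δ ≤ (sampleLaw N P).real
      {X | readParams (2 * k - 1) k (estimator (k, digitize X)) ∈ models (2 * k - 1) k ∧
        modelDist θ (readParams (2 * k - 1) k (estimator (k, digitize X))) < ε} := by
  have hprobP := hP.isProbabilityMeasure hθ.1
  have hprob : IsProbabilityMeasure (sampleLaw N P) := by unfold sampleLaw; infer_instance
  -- For `ε > 1` every model is an acceptable answer, so no lower bound on `N` is needed.
  rcases lt_or_ge 1 ε with hε1 | hε1
  · have huniv : {X : Fin N → Fin (2 * k - 1) → ℝ |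
        readParams (2 * k - 1) k (estimator (k, digitize X)) ∈ models (2 * k - 1) k ∧
        modelDist θ (readParams (2 * k - 1) k (estimator (k, digitize X))) < ε} = Set.univ :=
      Set.eq_univ_of_forall fun X =>
        ⟨readParams_estimator_mem_models hk _, (modelDist_le_one (by omega) (by omega) hθ.1
          (readParams_estimator_mem_models hk _)).trans_lt hε1⟩
    rw [huniv, probReal_univ]
    linarith
  have hp1 : p ≤ 1 := (hθ.2.1 ⟨0, hk⟩).trans (by
    rw [← hθ.1.1.2]
    exact Finset.single_le_sum (fun j _ => hθ.1.1.1 j) (Finset.mem_univ _))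
  have hz : 1 ≤ 1 / ζ := by rw [le_div_iff₀ hζ]; linarith
  have hq : 1 ≤ 1 / p := by rw [le_div_iff₀ hp]; linarith
  have hk' : (1 : ℝ) ≤ k := by exact_mod_cast hk
  set ℓ := Real.log (1 / δ) with hℓ
  have hℓ2 : 1 / 2 ≤ ℓ := by
    have h1 : Real.log 2 ≤ ℓ :=
      Real.log_le_log (by norm_num) (by rw [le_div_iff₀ hδ]; linarith)
    have := Real.log_two_gt_d9
    linarith
  set K : ℝ := 25 * (k * (2 * (1 / ζ)) ^ (4 * k) * (1 / p) ^ 2) with hK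
  have hK1 : 1 ≤ K := by
    have h1 : 1 ≤ (2 * (1 / ζ)) ^ (4 * k) := one_le_pow₀ (by linarith)
    have h2 : 1 ≤ (1 / p) ^ 2 := one_le_pow₀ hq
    have h3 := one_le_mul_of_one_le_of_one_le (one_le_mul_of_one_le_of_one_le hk' h1) h2
    linarith
  have hK0 : 0 < K := by linarith
  -- The accuracy of the moments that stability turns into `ε / 2`, leaving room for the strict
  -- inequality.
  set η : ℝ := ε / (2 * K) with hη
  have hη0 : 0 < η := by positivity
  have hη1 : η ≤ 1 := by rw [hη, div_le_one (by positivity)]; linarith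
  have hKη : K * η = ε / 2 := by rw [hη]; field_simp
  have hNη : 6 * k * 16 ^ k * ℓ ≤ N * η ^ 2 := by
    have h1 := sample_bound hC hk hz hq (two_pow_le_of_separated hk hζ hζ1 hθ)
    rw [← hK] at h1
    have h2 : 24 * k * 16 ^ k * K ^ 2 * (1 / ε) ^ 2 * ℓ ≤ N := by
      refine le_trans ?_ hN
      gcongr
    have h3 : η ^ 2 * (24 * k * 16 ^ k * K ^ 2 * (1 / ε) ^ 2 * ℓ) = 6 * k * 16 ^ k * ℓ := by
      rw [hη]; field_simp; ring
    rw [← h3, mul_comm (N : ℝ)]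
    exact mul_le_mul_of_nonneg_left h2 (by positivity)
  have hN3 : 3 * k * 16 ^ k ≤ N * η ^ 2 := by
    refine le_trans ?_ hNη
    have : (0 : ℝ) ≤ k * 16 ^ k := by positivity
    nlinarith
  have hNpos : 0 < N := by
    rcases Nat.eq_zero_or_pos N with rfl | h
    · have : (0 : ℝ) < 3 * k * 16 ^ k := by positivity
      simp only [Nat.cast_zero, zero_mul] at hN3
      linarith
    · exact h
  -- The search loses a factor `4^k`; half of `η` is left for rounding the data and the grid.
  set h : ℝ := η / (2 * 4 ^ k) with hh
  have hh0 : 0 < h := by positivity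
  have h16 : (16 : ℝ) ^ k = 4 ^ k * 4 ^ k := by rw [← mul_pow]; norm_num
  have hprobbound : 2 ^ (2 * k - 1) * (2 * Real.exp (-(2 * N * h ^ 2))) ≤ δ := by
    refine four_pow_mul_exp_le hk hδ hδ2 ?_
    have e : 2 * (N : ℝ) * h ^ 2 = N * η ^ 2 / (2 * 16 ^ k) := by
      rw [hh, h16]; field_simp
    rw [e, le_div_iff₀ (by positivity)]
    linarith
  have hgrid : 4 ^ k * (h + 5 * k / 2 ^ N) ≤ η := by
    have e1 : (4 : ℝ) ^ k * h = η / 2 := by rw [hh]; field_simp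
    have h2N : (N : ℝ) ≤ 2 ^ N := by exact_mod_cast Nat.lt_two_pow_self.le
    have e2 : (4 : ℝ) ^ k * (5 * k / 2 ^ N) ≤ η / 2 := by
      rw [mul_div_assoc', div_le_iff₀ (by positivity)]
      have h4 : (4 : ℝ) ≤ 4 ^ k := by
        calc (4 : ℝ) = 4 ^ 1 := (pow_one _).symm
          _ ≤ 4 ^ k := pow_le_pow_right₀ (by norm_num) hk
      have h5 : N * η ^ 2 ≤ η * 2 ^ N := by
        calc N * η ^ 2 = (N * η) * η := by ring
          _ ≤ (N * η) * 1 := by gcongr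
          _ ≤ η * 2 ^ N := by rw [mul_one, mul_comm]; gcongr
      have h6 : (4 : ℝ) * (k * 4 ^ k) ≤ 4 ^ k * (k * 4 ^ k) := by gcongr
      have h7 : (0 : ℝ) ≤ k * 4 ^ k := by positivity
      rw [h16] at hN3
      linarith
    rw [mul_add]
    linarith
  have hge := hP.sampleLaw_real_ge hNpos hθ.1 hh0.le
  -- Monotonicity holds for arbitrary sets, so measurability of the success event is not needed.
  refine le_trans (by linarith) (hge.trans (measureReal_mono ?_))
  rintro X ⟨hX, hemp⟩
  refine ⟨readParams_estimator_mem_models hk _, ?_⟩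
  have eK : 25 * (k * (2 / ζ) ^ (4 * k) * η / p ^ 2) = ε / 2 := by
    rw [← hKη, hK, mul_one_div, one_div, inv_pow]; ring
  have := modelDist_le_of_moment hk hζ hζ1 hp hθ (readParams_estimator_mem_models hk _)
    (fun S => (abs_moment_estimator_digitize_sub_le hk hNpos hθ.1 hX hemp S).trans hgrid)
    (by rw [eK]; linarith)
  rw [eK] at this
  linarith

end MixProd

theorem corollary3p2 :
    ∃ (C : ℕ) (alg : ℕ × List (List ℕ) → ℕ × List ℕ × List (List ℕ)),
      Computable alg ∧
      ∀ (k : ℕ) (ζ πmin ε δ : ℝ), 1 ≤ k → 0 < ζ → ζ ≤ 1 → 0 < πmin → 0 < ε →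
        0 < δ → δ ≤ 1 / 2 →
      ∀ N : ℕ,
        (C : ℝ) * (1 / ζ) ^ (C * k) * (1 / πmin) ^ C * (1 / ε) ^ 2 * Real.log (1 / δ) ≤ (N : ℝ) →
      ∀ θ ∈ MixProd.separatedModels (2 * k - 1) k ζ πmin,
      ∀ P : MeasureTheory.Measure (Fin (2 * k - 1) → ℝ), MixProd.IsMixtureLaw θ P →
        1 - δ ≤ (MixProd.sampleLaw N P).real
          {X | MixProd.readParams (2 * k - 1) k (alg (k, MixProd.digitize X)) ∈
                MixProd.models (2 * k - 1) k ∧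
              MixProd.modelDist θ
                (MixProd.readParams (2 * k - 1) k (alg (k, MixProd.digitize X))) < ε} := by
  refine ⟨2 ^ 44, MixProd.estimator, MixProd.primrec_estimator.to_comp, ?_⟩
  intro k ζ πmin ε δ hk hζ hζ1 hp hε hδ hδ2 N hN θ hθ P hP
  exact MixProd.estimator_succeeds le_rfl hk hζ hζ1 hp hε hδ hδ2 hN hθ hP
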